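/- Let $\lambda,\mu>0$, $\xi\ge 0$ and $\alpha\in(0,1]$. Let $\{X^\alpha_t\}_{t\ge 0}$ be a fractional $M/M/1$ queue with catastrophes of parameter $\alpha$, with arrival rate $\lambda$, service rate $\mu$ and catastrophe rate $\xi$; that is, an $\mathbb{N}_0$-valued process whose transition probabilities $P^\alpha_{i,n}(t)=P(X^\alpha_t=n\mid X^\alpha_0=i)$ are continuous in $t\ge0$, satisfy $P^\alpha_{i,n}(0)=\delta_{i,n}$ and, for $t>0$, $$D^\alpha_tP^\alpha_{i,0}=-(\lambda+\xi)P^\alpha_{i,0}+\mu P^\alpha_{i,1}+\xi,\qquad D^\alpha_tP^\alpha_{i,n}=-(\lambda+\mu+\xi)P^\alpha_{i,n}+\lambda P^\alpha_{i,n-1}+\mu P^\alpha_{i,n+1}\quad(n\ge 1),$$ where $D^\alpha_t$ is the Caputo derivative of order $\alpha$, $D^\alpha_tf=\frac{d}{dt}J^{1-\alpha}(f-f(0))$, with $J^\beta f(t)=\frac1{\Gamma(\beta)}\int_0^t(t-s)^{\beta-1}f(s)\,ds$ for $\beta>0$ and $J^0f=f$ (so $D^1_t=d/dt$). Let $$E^\delta_{\beta,\gamma}(w)=\sum_{r=0}^\infty\frac{w^r\,\Gamma(\delta+r)}{r!\,\Gamma(\beta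 r+\gamma)\,\Gamma(\delta)}$$ be the three-parameter Mittag-Leffler function, and let $(f\ast g)(t)=\int_0^tf(u)g(t-u)\,du$. Then for every initial state $i$ (with $P(X^\alpha_0=i)>0$) and every $t\ge0$, conditionally on $X^\alpha_0=i$, the variable $X^\alpha_t$ has a finite second moment and, if $\xi>0$, $$\begin{aligned}\mathrm{Var}(X^\alpha_t)={}&i^2E^1_{\alpha,1}(-\xi t^\alpha)+2it^\alpha(\lambda-\mu)E^2_{\alpha,\alpha+1}(-\xi t^\alpha)-\mu\,[P^\alpha_{i,0}(t)\ast t^{\alpha-1}E^1_{\alpha,\alpha}(-\xi t^\alpha)]\\&+2\mu(\lambda-\mu)\,[P^\alpha_{i,0}(t)\ast t^{2\alpha-1}E^2_{\alpha,2\alpha}(-\xi t^\alpha)]+(\mu+\lambda)t^\alpha E^1_{\alpha,\alpha+1}(-\xi t^\alpha)+2t^{2\alpha}(\lambda-\mu)^2E^2_{\alpha,2\alpha+1}(-\xi t^\alpha)\\&-\Big[iE^1_{\alpha,1}(-\xi t^\alpha)+\mu\,P^\alpha_{i,0}(t)\ast t^{\alpha-1}E^1_{\alpha,\alpha}(-\xi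 t^\alpha)+\frac{\lambda-\mu}{\xi}\big(1-E^1_{\alpha,1}(-\xi t^\alpha)\big)\Big]^2.\end{aligned}$$ Moreover, for every $\xi\ge0$ (including $\xi=0$) the same formula holds with $\frac{\lambda-\mu}{\xi}\big(1-E^1_{\alpha,1}(-\xi t^\alpha)\big)$ replaced by $(\lambda-\mu)t^\alpha E^1_{\alpha,\alpha+1}(-\xi t^\alpha)$. -/

import Mathlib

open MeasureTheory ProbabilityTheory Set
open scoped NNReal

noncomputable section

/-- The three-parameter (Prabhakar) Mittag-Leffler function
`E^δ_{β,γ}(w) = ∑_{r ≥ 0} Γ(δ+r) w^r / (r! Γ(βr+γ) Γ(δ))`, for real parameters and argument. -/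
def mittagLeffler (δ β γ w : ℝ) : ℝ :=
  ∑' r : ℕ, w ^ r * Real.Gamma (δ + r) /
    ((Nat.factorial r : ℝ) * Real.Gamma (β * r + γ) * Real.Gamma δ)

/-- The convolution `(f ∗ g)(t) = ∫₀ᵗ f(u) g(t - u) du` of functions of time. -/
def timeConv (f g : ℝ → ℝ) (t : ℝ) : ℝ :=
  ∫ u in (0 : ℝ)..t, f u * g (t - u)

/-- The Riemann-Liouville fractional integral of order `β ≥ 0` based at `0`:
`(J^β f)(t) = Γ(β)⁻¹ ∫₀ᵗ (t - s)^(β-1) f(s) ds` for `β > 0`, and `J^0 f = f`. -/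
def fracIntegral (β : ℝ) (f : ℝ → ℝ) (t : ℝ) : ℝ :=
  if β = 0 then f t
  else (Real.Gamma β)⁻¹ * ∫ s in (0 : ℝ)..t, (t - s) ^ (β - 1) * f s

/-- `f` has at time `t` the Caputo derivative `d` of order `α ∈ (0,1]` (based at `0`):
`d = d/dt J^{1-α}(f - f(0))`, the derivative being required to exist. For absolutely continuous
`f` and `α < 1` this agrees a.e. with `Γ(1-α)⁻¹ ∫₀ᵗ (t - s)^(-α) f'(s) ds`; for `α = 1` it is `f'(t)`. -/
def HasCaputoDerivAt (α : ℝ) (f : ℝ → ℝ) (d t : ℝ) : Prop :=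
  HasDerivAt (fracIntegral (1 - α) (fun s => f s - f 0)) d t

/-- `transitionProb P X i n t = P(X_t = n | X_0 = i)`, for real `t ≥ 0`. -/
def transitionProb {Ω : Type*} [MeasurableSpace Ω] (P : Measure Ω) (X : ℝ≥0 → Ω → ℕ)
    (i n : ℕ) (t : ℝ) : ℝ :=
  (cond P (X 0 ⁻¹' {i})).real (X t.toNNReal ⁻¹' {n})

/-- `X` is a fractional M/M/1 queue with catastrophes of parameter `α ∈ (0,1]`, with arrival rate
`lam`, service rate `μ` and catastrophe rate `ξ`: for each state `i` in which the process can
start, the transition probabilities out of `i` are continuous in time and satisfy the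
fractional Kolmogorov forward equations. For `α = 1` these are the ordinary ones. -/
structure IsFractionalQueue {Ω : Type*} [MeasurableSpace Ω] (P : Measure Ω)
    (α lam μ ξ : ℝ) (X : ℝ≥0 → Ω → ℕ) : Prop where
  measurable : ∀ t, Measurable (X t)
  continuousOn : ∀ i n, P (X 0 ⁻¹' {i}) ≠ 0 →
    ContinuousOn (transitionProb P X i n) (Ici 0)
  init : ∀ i n, P (X 0 ⁻¹' {i}) ≠ 0 →
    transitionProb P X i n 0 = if i = n then 1 else 0
  forward_zero : ∀ i, P (X 0 ⁻¹' {i}) ≠ 0 → ∀ t : ℝ, 0 < t →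
    HasCaputoDerivAt α (transitionProb P X i 0)
      (-(lam + ξ) * transitionProb P X i 0 t + μ * transitionProb P X i 1 t + ξ) t
  forward_pos : ∀ i n, 1 ≤ n → P (X 0 ⁻¹' {i}) ≠ 0 → ∀ t : ℝ, 0 < t →
    HasCaputoDerivAt α (transitionProb P X i n)
      (-(lam + μ + ξ) * transitionProb P X i n t + lam * transitionProb P X i (n - 1) t
        + μ * transitionProb P X i (n + 1) t) t

/-- `(P_{i,0} ∗ [s^{δα-1} E^δ_{α,δα}(-ξ s^α)])(t)`, where `p0 = P_{i,0}`. -/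
def mlConv (α ξ δ : ℝ) (p0 : ℝ → ℝ) (t : ℝ) : ℝ :=
  timeConv p0 (fun s => s ^ (δ * α - 1) * mittagLeffler δ α (δ * α) (-ξ * s ^ α)) t

end

/-!
The transition probabilities extend by linearity to truncated observables `φ (min n N)`: each
satisfies the fractional Dynkin formula `E φ(X_t) = φ(i) + J^α E (Lφ)(X)(t)` for the generator `L`
of the queue. Truncating `V n = 1 + n²`, which satisfies `L V ≤ c V` uniformly in the truncation, a
fractional Grönwall inequality bounds `E V(X_t)` by a Mittag-Leffler function; dominated convergence
then yields the Dynkin formula for `n` and `n²`. Since `L n = (λ - μ) + μ 1_{n=0} - ξ n` and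
`L n² = (λ + μ) - μ 1_{n=0} + 2(λ - μ) n - ξ n²`, both moments solve equations
`v = g + J^α s - ξ J^α v`, which are inverted by the resolvent `(1 + ξ J^α)⁻¹`; the mean enters the
source of the second moment, so there `(1 + ξ J^α)⁻²` appears as well. Expanding
`(1 - c J^α)^{-d} J^γ` in its binomial series and summing under the integral gives convolution with
`s^{γ-1} E^d_{α,γ}(c s^α)`.
-/

/-- Measurable functions of time that are bounded on every interval `[0, T]`: a class of functions
which fractional integration of any order preserves. -/
structure MeasurableLocallyBounded (f : ℝ → ℝ) : Prop where
  measurable : Measurable f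
  bounded : ∀ T : ℝ, ∃ C : ℝ, ∀ s ∈ Icc 0 T, |f s| ≤ C

namespace MeasurableLocallyBounded

theorem const (c : ℝ) : MeasurableLocallyBounded fun _ => c :=
  ⟨measurable_const, fun _ => ⟨|c|, fun _ _ => le_rfl⟩⟩

theorem of_continuous {f : ℝ → ℝ} (hf : Continuous f) : MeasurableLocallyBounded f :=
  ⟨hf.measurable, fun _ => isCompact_Icc.exists_bound_of_continuousOn hf.continuousOn⟩

variable {f g : ℝ → ℝ}

theorem add (hf : MeasurableLocallyBounded f) (hg : MeasurableLocallyBounded g) :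
    MeasurableLocallyBounded (f + g) := by
  refine ⟨hf.measurable.add hg.measurable, fun T => ?_⟩
  obtain ⟨C, hC⟩ := hf.bounded T
  obtain ⟨D, hD⟩ := hg.bounded T
  exact ⟨C + D, fun s hs => (abs_add_le _ _).trans (add_le_add (hC s hs) (hD s hs))⟩

theorem const_smul (c : ℝ) (hf : MeasurableLocallyBounded f) :
    MeasurableLocallyBounded (c • f) := by
  refine ⟨hf.measurable.const_smul c, fun T => ?_⟩
  obtain ⟨C, hC⟩ := hf.bounded T
  refine ⟨|c| * C, fun s hs => ?_⟩
  rw [Pi.smul_apply, smul_eq_mul, abs_mul]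
  exact mul_le_mul_of_nonneg_left (hC s hs) (abs_nonneg c)

end MeasurableLocallyBounded

section FracIntegral

theorem fracIntegral_zero (f : ℝ → ℝ) : fracIntegral 0 f = f :=
  funext fun _ => if_pos rfl

theorem fracIntegral_one (f : ℝ → ℝ) (t : ℝ) : fracIntegral 1 f t = ∫ s in 0..t, f s := by
  simp [fracIntegral]

variable {β : ℝ}

theorem fracIntegral_of_pos (hβ : 0 < β) (f : ℝ → ℝ) (t : ℝ) :
    fracIntegral β f t = (Real.Gamma β)⁻¹ * ∫ s in 0..t, (t - s) ^ (β - 1) * f s :=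
  if_neg hβ.ne'

theorem fracIntegral_smul (β c : ℝ) (f : ℝ → ℝ) :
    fracIntegral β (c • f) = c • fracIntegral β f := by
  funext t
  simp only [fracIntegral, Pi.smul_apply, smul_eq_mul, mul_left_comm _ c,
    intervalIntegral.integral_const_mul, mul_ite]

theorem fracIntegral_congr {f g : ℝ → ℝ} {t : ℝ} (ht : 0 ≤ t) (h : EqOn f g (Icc 0 t)) (β : ℝ) :
    fracIntegral β f t = fracIntegral β g t := by
  unfold fracIntegral
  rw [h ⟨ht, le_rfl⟩, intervalIntegral.integral_congr]
  intro s hs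
  rw [uIcc_of_le ht] at hs
  simp only [h hs]

theorem intervalIntegrable_sub_rpow (hβ : 0 < β) (t : ℝ) :
    IntervalIntegrable (fun s => (t - s) ^ (β - 1)) volume 0 t := by
  simpa using ((intervalIntegral.intervalIntegrable_rpow' (a := 0) (b := t)
    (r := β - 1) (by linarith)).comp_sub_left t).symm

theorem integral_sub_rpow (hβ : 0 < β) (t : ℝ) :
    ∫ s in 0..t, (t - s) ^ (β - 1) = t ^ β / β := by
  rw [intervalIntegral.integral_comp_sub_left (· ^ (β - 1)) t,
    integral_rpow (Or.inl (by linarith))]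
  simp [Real.zero_rpow hβ.ne']

theorem fracIntegral_const (hβ : 0 ≤ β) (c t : ℝ) :
    fracIntegral β (fun _ => c) t = c * (t ^ β / Real.Gamma (β + 1)) := by
  rcases hβ.eq_or_lt with rfl | hβ
  · simp [fracIntegral_zero]
  · rw [fracIntegral_of_pos hβ, intervalIntegral.integral_mul_const, integral_sub_rpow hβ,
      Real.Gamma_add_one hβ.ne']
    ring

theorem measurable_fracIntegral {f : ℝ → ℝ} (hf : Measurable f) (β : ℝ) :
    Measurable (fracIntegral β f) := by
  rcases eq_or_ne β 0 with rfl | hβ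
  · rwa [fracIntegral_zero]
  let kernel : ℝ × ℝ → ℝ := {p | p.2 ∈ uIoc 0 p.1}.indicator fun p => (p.1 - p.2) ^ (β - 1) * f p.2
  have hset : MeasurableSet {p : ℝ × ℝ | p.2 ∈ uIoc 0 p.1} := by
    simp only [mem_uIoc]
    measurability
  have hkernel : Measurable kernel := Measurable.indicator (by fun_prop) hset
  have hintegral : ∀ t, ∫ s in uIoc 0 t, (t - s) ^ (β - 1) * f s = ∫ s, kernel (t, s) := fun t =>
    (integral_indicator measurableSet_uIoc).symm
  have hfrac : fracIntegral β f = fun t => (Real.Gamma β)⁻¹ *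
      ((if 0 ≤ t then 1 else -1 : ℝ) • ∫ s, kernel (t, s)) := by
    funext t
    rw [fracIntegral, if_neg hβ, intervalIntegral.intervalIntegral_eq_integral_uIoc, hintegral]
  have hsign : Measurable fun t : ℝ => (if 0 ≤ t then 1 else -1 : ℝ) :=
    .ite measurableSet_Ici measurable_const measurable_const
  rw [hfrac]
  exact (hsign.smul hkernel.stronglyMeasurable.integral_prod_right'.measurable).const_mul _

namespace MeasurableLocallyBounded

variable {f g : ℝ → ℝ} {t : ℝ}

theorem intervalIntegrable_mul {k : ℝ → ℝ} (hf : MeasurableLocallyBounded f)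
    (hk : IntervalIntegrable k volume 0 t) (ht : 0 ≤ t) :
    IntervalIntegrable (fun s => k s * f s) volume 0 t := by
  obtain ⟨C, hC⟩ := hf.bounded t
  rw [intervalIntegrable_iff_integrableOn_Ioc_of_le ht] at hk ⊢
  refine hk.mul_bdd (c := C) hf.measurable.aestronglyMeasurable ?_
  filter_upwards [ae_restrict_mem measurableSet_Ioc] with s hs using hC s ⟨hs.1.le, hs.2⟩

theorem fracIntegral_add (hf : MeasurableLocallyBounded f) (hg : MeasurableLocallyBounded g)
    (hβ : 0 ≤ β) (ht : 0 ≤ t) :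
    fracIntegral β (f + g) t = fracIntegral β f t + fracIntegral β g t := by
  rcases hβ.eq_or_lt with rfl | hβ
  · simp [fracIntegral_zero]
  · have hkernel := intervalIntegrable_sub_rpow hβ t
    simp only [fracIntegral_of_pos hβ, Pi.add_apply, mul_add]
    rw [intervalIntegral.integral_add (hf.intervalIntegrable_mul hkernel ht)
      (hg.intervalIntegrable_mul hkernel ht), mul_add]

theorem fracIntegral_mono (hf : MeasurableLocallyBounded f) (hg : MeasurableLocallyBounded g)
    (hβ : 0 ≤ β) (ht : 0 ≤ t) (h : ∀ s ∈ Icc 0 t, f s ≤ g s) :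
    fracIntegral β f t ≤ fracIntegral β g t := by
  rcases hβ.eq_or_lt with rfl | hβ
  · simpa only [fracIntegral_zero] using h t ⟨ht, le_rfl⟩
  · have hkernel := intervalIntegrable_sub_rpow hβ t
    rw [fracIntegral_of_pos hβ, fracIntegral_of_pos hβ]
    refine mul_le_mul_of_nonneg_left ?_ (inv_nonneg.2 (Real.Gamma_pos_of_pos hβ).le)
    exact intervalIntegral.integral_mono_on ht (hf.intervalIntegrable_mul hkernel ht)
      (hg.intervalIntegrable_mul hkernel ht) fun s hs =>
        mul_le_mul_of_nonneg_left (h s hs) (Real.rpow_nonneg (sub_nonneg.2 hs.2) _)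

theorem abs_fracIntegral_le (hf : MeasurableLocallyBounded f) (hβ : 0 ≤ β) {C : ℝ} (ht : 0 ≤ t)
    (h : ∀ s ∈ Icc 0 t, |f s| ≤ C) :
    |fracIntegral β f t| ≤ C * (t ^ β / Real.Gamma (β + 1)) := by
  have hupper := hf.fracIntegral_mono (.const C) hβ ht fun s hs => (abs_le.1 (h s hs)).2
  have hlower := (const (-C)).fracIntegral_mono hf hβ ht fun s hs => (abs_le.1 (h s hs)).1
  rw [fracIntegral_const hβ] at hupper hlower
  exact abs_le.2 ⟨by linarith, hupper⟩

protected theorem fracIntegral (hf : MeasurableLocallyBounded f) (hβ : 0 ≤ β) :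
    MeasurableLocallyBounded (fracIntegral β f) := by
  refine ⟨measurable_fracIntegral hf.measurable β, fun T => ?_⟩
  obtain ⟨C, hC⟩ := hf.bounded T
  have : 0 < Real.Gamma (β + 1) := Real.Gamma_pos_of_pos (by linarith)
  refine ⟨C * (T ^ β / Real.Gamma (β + 1)), fun t ht => ?_⟩
  have hC0 : 0 ≤ C := (abs_nonneg _).trans (hC t ht)
  refine (hf.abs_fracIntegral_le hβ ht.1 fun s hs => hC s ⟨hs.1, hs.2.trans ht.2⟩).trans ?_
  gcongr
  exacts [ht.1, ht.2]

end MeasurableLocallyBounded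

theorem tendsto_fracIntegral {F : ℕ → ℝ → ℝ} {f : ℝ → ℝ} {C t : ℝ} (hβ : 0 ≤ β) (ht : 0 ≤ t)
    (hF : ∀ n, Measurable (F n)) (hbound : ∀ n, ∀ s ∈ Icc 0 t, |F n s| ≤ C)
    (hlim : ∀ s ∈ Icc 0 t, Filter.Tendsto (F · s) Filter.atTop (nhds (f s))) :
    Filter.Tendsto (fun n => fracIntegral β (F n) t) Filter.atTop
      (nhds (fracIntegral β f t)) := by
  rcases hβ.eq_or_lt with rfl | hβ
  · simpa only [fracIntegral_zero] using hlim t ⟨ht, le_rfl⟩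
  simp only [fracIntegral_of_pos hβ]
  have hIcc : ∀ s ∈ uIoc 0 t, s ∈ Icc 0 t := fun s hs => uIcc_of_le ht ▸ uIoc_subset_uIcc hs
  refine .const_mul _ <| intervalIntegral.tendsto_integral_filter_of_dominated_convergence
    (fun s => (t - s) ^ (β - 1) * C) (.of_forall fun n => ?_) (.of_forall fun n => ?_)
    ((intervalIntegrable_sub_rpow hβ t).mul_const C) (.of_forall fun s hs => ?_)
  · exact (((measurable_const.sub measurable_id).pow_const _).mul (hF n)).aestronglyMeasurable
  · refine .of_forall fun s hs => ?_
    have hrpow : 0 ≤ (t - s) ^ (β - 1) := Real.rpow_nonneg (sub_nonneg.2 (hIcc s hs).2) _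
    rw [Real.norm_eq_abs, abs_mul, abs_of_nonneg hrpow]
    exact mul_le_mul_of_nonneg_left (hbound n s (hIcc s hs)) hrpow
  · exact (hlim s (hIcc s hs)).const_mul _

end FracIntegral

section Semigroup

open scoped Convolution

theorem timeConv_smul_left (c : ℝ) (f g : ℝ → ℝ) : timeConv (c • f) g = c • timeConv f g := by
  funext t
  simp only [timeConv, Pi.smul_apply, smul_eq_mul, mul_assoc, intervalIntegral.integral_const_mul]

theorem timeConv_smul_right (c : ℝ) (f g : ℝ → ℝ) : timeConv f (c • g) = c • timeConv f g := by
  funext t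
  simp only [timeConv, Pi.smul_apply, smul_eq_mul, mul_left_comm _ c,
    intervalIntegral.integral_const_mul]

theorem timeConv_congr {f g h k : ℝ → ℝ} {t : ℝ} (ht : 0 ≤ t) (hfh : EqOn f h (Ioo 0 t))
    (hgk : EqOn g k (Ioo 0 t)) : timeConv f g t = timeConv h k t := by
  simp only [timeConv, intervalIntegral.integral_of_le ht, integral_Ioc_eq_integral_Ioo]
  refine setIntegral_congr_fun measurableSet_Ioo fun u hu => ?_
  simp only [hfh hu, hgk (show t - u ∈ Ioo 0 t from ⟨sub_pos.2 hu.2, sub_lt_self t hu.1⟩)]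

theorem convolution_eq_timeConv {f g : ℝ → ℝ} {x : ℝ} (hx : 0 ≤ x)
    (h : ∀ u ∉ Ioo 0 x, f u * g (x - u) = 0) : (f ⋆[.mul ℝ ℝ] g) x = timeConv f g x := by
  rw [timeConv, intervalIntegral.integral_of_le hx, integral_Ioc_eq_integral_Ioo]
  exact (setIntegral_eq_integral_of_forall_compl_eq_zero h).symm

theorem convolution_indicator_Ioo_left (f g : ℝ → ℝ) {t : ℝ} (ht : 0 ≤ t) :
    ((Ioo 0 t).indicator f ⋆[.mul ℝ ℝ] g) t = timeConv f g t := by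
  rw [convolution_eq_timeConv ht fun u hu => by simp [hu]]
  exact timeConv_congr ht (eqOn_indicator ..) fun _ _ => rfl

theorem convolution_indicator_Ioo_right (f g : ℝ → ℝ) {t : ℝ} (ht : 0 ≤ t) :
    (f ⋆[.mul ℝ ℝ] (Ioo 0 t).indicator g) t = timeConv f g t := by
  rw [convolution_eq_timeConv ht fun u hu => ?_]
  · exact timeConv_congr ht (fun _ _ => rfl) (eqOn_indicator ..)
  · rw [indicator_of_notMem (by simpa [and_comm] using hu), mul_zero]

theorem eqOn_convolution_indicator_Ioo (f g : ℝ → ℝ) (t : ℝ) :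
    EqOn ((Ioo 0 t).indicator f ⋆[.mul ℝ ℝ] (Ioo 0 t).indicator g) (timeConv f g) (Ioo 0 t) := by
  intro x hx
  have hsub : Ioo 0 x ⊆ Ioo 0 t := Ioo_subset_Ioo_right hx.2.le
  rw [convolution_eq_timeConv hx.1.le fun u hu => ?_]
  · exact timeConv_congr hx.1.le ((eqOn_indicator ..).mono hsub) ((eqOn_indicator ..).mono hsub)
  · rcases le_or_gt u 0 with hu0 | hu0
    · simp [hu0.not_gt]
    · simp [show x ≤ u from not_lt.1 fun h => hu ⟨hu0, h⟩]

theorem convolution_assoc_of_bounded {f g h : ℝ → ℝ} {C : ℝ} (hf : Integrable f)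
    (hbound : ∀ x, |f x| ≤ C) (hg : Integrable g) (hh : Integrable h) (x : ℝ) :
    ((f ⋆[.mul ℝ ℝ] g) ⋆[.mul ℝ ℝ] h) x = (f ⋆[.mul ℝ ℝ] (g ⋆[.mul ℝ ℝ] h)) x := by
  refine convolution_assoc (.mul ℝ ℝ) (.mul ℝ ℝ) (.mul ℝ ℝ) (.mul ℝ ℝ) mul_assoc
    hf.aestronglyMeasurable hg.aestronglyMeasurable hh.aestronglyMeasurable
    (hf.ae_convolution_exists _ hg) (hg.norm.ae_convolution_exists _ hh.norm) ?_
  exact ((hg.norm.integrable_convolution (.mul ℝ ℝ) hh.norm).comp_sub_left x).bdd_mul (c := C)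
    hf.norm.aestronglyMeasurable (.of_forall fun s => by simpa using hbound s)

theorem MeasurableLocallyBounded.timeConv_assoc {f g h : ℝ → ℝ} {t : ℝ}
    (hf : MeasurableLocallyBounded f) (hg : IntervalIntegrable g volume 0 t)
    (hh : IntervalIntegrable h volume 0 t) (ht : 0 ≤ t) :
    timeConv (timeConv f g) h t = timeConv f (timeConv g h) t := by
  rcases ht.eq_or_lt with rfl | ht
  · simp [timeConv]
  let cut (k : ℝ → ℝ) : ℝ → ℝ := (Ioo 0 t).indicator k
  have hcut_integrable {k : ℝ → ℝ} (hk : IntervalIntegrable k volume 0 t) : Integrable (cut k) :=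
    (integrable_indicator_iff measurableSet_Ioo).2 (((intervalIntegrable_iff_integrableOn_Ioc_of_le
      ht.le).1 hk).mono_set Ioo_subset_Ioc_self)
  have hf_integrable : IntervalIntegrable f volume 0 t := by
    simpa using hf.intervalIntegrable_mul (k := fun _ => 1) (by simp) ht.le
  obtain ⟨C, hC⟩ := hf.bounded t
  have hcut_bound (x : ℝ) : |cut f x| ≤ C := by
    by_cases hx : x ∈ Ioo 0 t
    · simpa [cut, hx] using hC x (Ioo_subset_Icc_self hx)
    · simpa [cut, hx] using (abs_nonneg _).trans (hC t ⟨ht.le, le_rfl⟩)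
  calc timeConv (timeConv f g) h t
      = ((cut f ⋆[.mul ℝ ℝ] cut g) ⋆[.mul ℝ ℝ] cut h) t := by
        rw [convolution_indicator_Ioo_right _ _ ht.le]
        exact timeConv_congr ht.le (eqOn_convolution_indicator_Ioo f g t).symm fun _ _ => rfl
    _ = (cut f ⋆[.mul ℝ ℝ] (cut g ⋆[.mul ℝ ℝ] cut h)) t :=
        convolution_assoc_of_bounded (hcut_integrable hf_integrable) hcut_bound
          (hcut_integrable hg) (hcut_integrable hh) t
    _ = timeConv f (timeConv g h) t := by
        rw [convolution_indicator_Ioo_left _ _ ht.le]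
        exact timeConv_congr ht.le (fun _ _ => rfl) (eqOn_convolution_indicator_Ioo g h t)

theorem timeConv_rpow_rpow {a b t : ℝ} (ha : 0 < a) (hb : 0 < b) (ht : 0 < t) :
    timeConv (· ^ (a - 1)) (· ^ (b - 1)) t = beta a b * t ^ (a + b - 1) := by
  have hcomplex : ((timeConv (· ^ (a - 1)) (· ^ (b - 1)) t : ℝ) : ℂ)
      = ∫ x in 0..t, (x : ℂ) ^ ((a : ℂ) - 1) * ((t : ℂ) - x) ^ ((b : ℂ) - 1) := by
    rw [timeConv, ← intervalIntegral.integral_ofReal]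
    refine intervalIntegral.integral_congr fun x hx => ?_
    rw [uIcc_of_le ht.le] at hx
    simp [Complex.ofReal_cpow hx.1, Complex.ofReal_cpow (sub_nonneg.2 hx.2)]
  apply Complex.ofReal_injective
  rw [hcomplex, Complex.betaIntegral_scaled _ _ ht,
    Complex.betaIntegral_eq_Gamma_mul_div _ _ (by simpa) (by simpa), beta]
  simp [Complex.ofReal_cpow ht.le, ← Complex.Gamma_ofReal, mul_comm]

theorem fracIntegral_eq_timeConv {β : ℝ} (hβ : 0 < β) (f : ℝ → ℝ) :
    fracIntegral β f = (Real.Gamma β)⁻¹ • timeConv f (· ^ (β - 1)) := by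
  funext t
  simp only [fracIntegral_of_pos hβ, timeConv, Pi.smul_apply, smul_eq_mul, mul_comm (f _)]

theorem MeasurableLocallyBounded.fracIntegral_fracIntegral {f : ℝ → ℝ}
    (hf : MeasurableLocallyBounded f) {a b : ℝ} (ha : 0 ≤ a) (hb : 0 ≤ b) {t : ℝ} (ht : 0 ≤ t) :
    fracIntegral a (fracIntegral b f) t = fracIntegral (a + b) f t := by
  rcases ha.eq_or_lt with rfl | ha
  · rw [fracIntegral_zero, zero_add]
  rcases hb.eq_or_lt with rfl | hb
  · rw [fracIntegral_zero, add_zero]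
  have hrpow {β : ℝ} (hβ : 0 < β) : IntervalIntegrable (fun s : ℝ => s ^ (β - 1)) volume 0 t :=
    intervalIntegral.intervalIntegrable_rpow' (by linarith)
  have hkernels : timeConv f (timeConv (· ^ (b - 1)) (· ^ (a - 1))) t
      = beta b a * timeConv f (· ^ (a + b - 1)) t := by
    rw [← smul_eq_mul, ← Pi.smul_apply, ← timeConv_smul_right]
    refine timeConv_congr ht (fun _ _ => rfl) fun s hs => ?_
    rw [timeConv_rpow_rpow hb ha hs.1, add_comm b a, Pi.smul_apply, smul_eq_mul]
  rw [fracIntegral_eq_timeConv ha, fracIntegral_eq_timeConv hb,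
    fracIntegral_eq_timeConv (add_pos ha hb), timeConv_smul_left]
  simp only [Pi.smul_apply, smul_eq_mul]
  rw [hf.timeConv_assoc (hrpow hb) (hrpow ha) ht, hkernels, beta, add_comm b a]
  have := (Real.Gamma_pos_of_pos ha).ne'
  have := (Real.Gamma_pos_of_pos hb).ne'
  field_simp

end Semigroup

section CaputoInversion

theorem fracIntegral_eq_rpow_mul_integral {β : ℝ} (hβ : 0 < β) (f : ℝ → ℝ) {t : ℝ} (ht : 0 ≤ t) :
    fracIntegral β f t
      = (Real.Gamma β)⁻¹ * (t ^ β * ∫ v in 0..1, (1 - v) ^ (β - 1) * f (t * v)) := by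
  rcases ht.eq_or_lt with rfl | ht
  · simp [fracIntegral_of_pos hβ, Real.zero_rpow hβ.ne']
  have hscale : ∫ s in 0..t, (t - s) ^ (β - 1) * f s
      = t * ∫ v in 0..1, (t - t * v) ^ (β - 1) * f (t * v) := by
    simpa using (intervalIntegral.smul_integral_comp_mul_left
      (f := fun s => (t - s) ^ (β - 1) * f s) (a := 0) (b := 1) t).symm
  have hrpow : t ^ β = t * t ^ (β - 1) := by
    rw [← Real.rpow_one_add' ht.le (by simpa using hβ.ne'), add_sub_cancel]
  rw [fracIntegral_of_pos hβ, hscale, hrpow, mul_assoc t,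
    ← intervalIntegral.integral_const_mul (t ^ (β - 1))]
  congr 2
  refine intervalIntegral.integral_congr fun v hv => ?_
  rw [uIcc_of_le zero_le_one] at hv
  simp only [← mul_one_sub, Real.mul_rpow ht.le (sub_nonneg.2 hv.2), mul_assoc]

theorem continuousOn_fracIntegral {f : ℝ → ℝ} (hf : Continuous f) {β : ℝ} (hβ : 0 ≤ β) :
    ContinuousOn (fracIntegral β f) (Ici 0) := by
  rcases hβ.eq_or_lt with rfl | hβ
  · simpa only [fracIntegral_zero] using hf.continuousOn
  refine ContinuousOn.congr ?_ fun t ht => fracIntegral_eq_rpow_mul_integral hβ f ht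
  refine continuousOn_const.mul ((Real.continuous_rpow_const hβ.le).continuousOn.mul ?_)
  refine Continuous.continuousOn (continuous_iff_continuousAt.2 fun t₀ => ?_)
  obtain ⟨C, hC⟩ := (isCompact_Icc (a := -(|t₀| + 1)) (b := |t₀| + 1)).exists_bound_of_continuousOn
    hf.continuousOn
  refine intervalIntegral.continuousAt_of_dominated_interval
    (bound := fun v => (1 - v) ^ (β - 1) * C) (.of_forall fun t => ?_) ?_
    ((intervalIntegrable_sub_rpow hβ 1).mul_const C) (.of_forall fun v _ => by fun_prop)
  · exact Measurable.aestronglyMeasurable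
      (((measurable_const.sub measurable_id).pow_const _).mul (by fun_prop))
  filter_upwards [Metric.ball_mem_nhds t₀ one_pos] with t ht
  refine .of_forall fun v hv => ?_
  rw [uIoc_of_le zero_le_one] at hv
  have hrpow : 0 ≤ (1 - v) ^ (β - 1) := Real.rpow_nonneg (sub_nonneg.2 hv.2) _
  have htv : |t * v| ≤ |t₀| + 1 := by
    rw [Metric.mem_ball, Real.dist_eq] at ht
    rw [abs_mul, abs_of_pos hv.1]
    exact (mul_le_of_le_one_right (abs_nonneg t) hv.2).trans
      (by linarith [abs_sub_abs_le_abs_sub t t₀])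
  rw [Real.norm_eq_abs, abs_mul, abs_of_nonneg hrpow]
  exact mul_le_mul_of_nonneg_left (hC _ (abs_le.1 htv)) hrpow

theorem eqOn_Ioi_of_integral_eq {f g : ℝ → ℝ} (hf : ContinuousOn f (Ici 0))
    (hg : ContinuousOn g (Ici 0)) (h : ∀ t, 0 ≤ t → ∫ s in 0..t, f s = ∫ s in 0..t, g s) :
    EqOn f g (Ioi 0) := by
  have hderiv {φ : ℝ → ℝ} (hφ : ContinuousOn φ (Ici 0)) {t : ℝ} (ht : 0 < t) :
      HasDerivAt (fun u => ∫ s in 0..u, φ s) (φ t) t := by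
    have hIcc : ContinuousOn φ (uIcc 0 t) :=
      hφ.mono (by rw [uIcc_of_le ht.le]; exact Icc_subset_Ici_self)
    exact intervalIntegral.integral_hasDerivAt_right hIcc.intervalIntegrable
      ((hφ.mono Ioi_subset_Ici_self).stronglyMeasurableAtFilter isOpen_Ioi t ht)
      (hφ.continuousAt (Ici_mem_nhds ht))
  intro t ht
  refine (hderiv hf ht).unique ((hderiv hg ht).congr_of_eventuallyEq ?_)
  filter_upwards [lt_mem_nhds ht] with s hs using h s hs.le

theorem fracIntegral_one_sub_eq_of_hasCaputoDerivAt {α : ℝ} (hα1 : α ≤ 1) {f F : ℝ → ℝ}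
    (hf : Continuous f) (hF : Continuous F) (h : ∀ t, 0 < t → HasCaputoDerivAt α f (F t) t) {t : ℝ}
    (ht : 0 ≤ t) : fracIntegral (1 - α) (fun s => f s - f 0) t = fracIntegral 1 F t := by
  have hzero : fracIntegral (1 - α) (fun s => f s - f 0) 0 = 0 := by
    simp [fracIntegral]
  have hftc := intervalIntegral.integral_eq_sub_of_hasDerivAt_of_le ht
    ((continuousOn_fracIntegral (by fun_prop) (sub_nonneg.2 hα1)).mono Icc_subset_Ici_self)
    (fun s hs => h s hs.1) (hF.intervalIntegrable _ _)
  rw [fracIntegral_one, hftc, hzero, sub_zero]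

theorem eq_add_fracIntegral_of_hasCaputoDerivAt {α : ℝ} (hα0 : 0 < α) (hα1 : α ≤ 1)
    {f F : ℝ → ℝ} (hf : Continuous f) (hF : Continuous F)
    (h : ∀ t, 0 < t → HasCaputoDerivAt α f (F t) t) {t : ℝ} (ht : 0 ≤ t) :
    f t = f 0 + fracIntegral α F t := by
  have hg : Continuous fun s => f s - f 0 := by fun_prop
  have hg_bdd := MeasurableLocallyBounded.of_continuous hg
  have hF_bdd := MeasurableLocallyBounded.of_continuous hF
  have hintegral (s : ℝ) (hs : 0 ≤ s) :
      ∫ x in 0..s, (f x - f 0) = ∫ x in 0..s, fracIntegral α F x := by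
    calc ∫ x in 0..s, (f x - f 0)
        = fracIntegral (α + (1 - α)) (fun x => f x - f 0) s := by
          rw [add_sub_cancel, fracIntegral_one]
      _ = fracIntegral α (fracIntegral (1 - α) fun x => f x - f 0) s :=
          (hg_bdd.fracIntegral_fracIntegral hα0.le (sub_nonneg.2 hα1) hs).symm
      _ = fracIntegral α (fracIntegral 1 F) s :=
          fracIntegral_congr hs (fun x hx =>
            fracIntegral_one_sub_eq_of_hasCaputoDerivAt hα1 hf hF h hx.1) α
      _ = ∫ x in 0..s, fracIntegral α F x := by
          rw [hF_bdd.fracIntegral_fracIntegral hα0.le zero_le_one hs, add_comm,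
            ← hF_bdd.fracIntegral_fracIntegral zero_le_one hα0.le hs, fracIntegral_one]
  rcases ht.eq_or_lt with rfl | ht
  · simp [fracIntegral_of_pos hα0]
  · exact sub_eq_iff_eq_add'.1 (eqOn_Ioi_of_integral_eq hg.continuousOn
      (continuousOn_fracIntegral hF hα0.le) hintegral ht)

end CaputoInversion

section MittagLeffler

theorem rpow_mul_exp_le_Gamma {x s : ℝ} (hx : 0 < x) (hs : 1 ≤ s) :
    x ^ (s - 1) * Real.exp (-(x + 1)) ≤ Real.Gamma s := by
  have hint := Real.GammaIntegral_convergent (zero_lt_one.trans_le hs)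
  have hsub : Ioc x (x + 1) ⊆ Ioi 0 := fun y hy => hx.trans hy.1
  rw [Real.Gamma_eq_integral (zero_lt_one.trans_le hs)]
  calc x ^ (s - 1) * Real.exp (-(x + 1))
      = ∫ _ in Ioc x (x + 1), Real.exp (-(x + 1)) * x ^ (s - 1) := by simp [mul_comm]
    _ ≤ ∫ y in Ioc x (x + 1), Real.exp (-y) * y ^ (s - 1) := by
        refine setIntegral_mono_on (integrableOn_const (by simp)) (hint.mono_set hsub)
          measurableSet_Ioc fun y hy => ?_
        gcongr
        exacts [hy.2, hy.1.le]
    _ ≤ ∫ y in Ioi 0, Real.exp (-y) * y ^ (s - 1) := by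
        refine setIntegral_mono_set hint ?_ hsub.eventuallyLE
        filter_upwards [ae_restrict_mem measurableSet_Ioi] with y hy
        exact mul_nonneg (Real.exp_pos _).le (Real.rpow_nonneg (le_of_lt hy) _)

variable {α : ℝ}

theorem summable_pow_div_Gamma (hα : 0 < α) (γ x : ℝ) :
    Summable fun k : ℕ => x ^ k / Real.Gamma (α * k + γ) := by
  set κ : ℝ := (|x| + 1) ^ α⁻¹
  have hκ : 0 < κ := by positivity
  have hκα : κ ^ α = |x| + 1 := Real.rpow_inv_rpow (by positivity) hα.ne'
  have hratio : |x| / κ ^ α < 1 := by rw [hκα, div_lt_one (by positivity)]; linarith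
  refine .of_norm_bounded_eventually_nat ((summable_geometric_of_lt_one (by positivity)
    hratio).mul_right (κ ^ (γ - 1) * Real.exp (-(κ + 1)))⁻¹) ?_
  have hlarge : ∀ᶠ k : ℕ in Filter.atTop, 1 ≤ α * k + γ :=
    (Filter.tendsto_atTop_add_const_right _ γ
      (tendsto_natCast_atTop_atTop.const_mul_atTop hα)).eventually_ge_atTop 1
  filter_upwards [hlarge] with k hk
  have hGamma : (κ ^ α) ^ k * (κ ^ (γ - 1) * Real.exp (-(κ + 1))) ≤ Real.Gamma (α * k + γ) := by
    rw [← Real.rpow_natCast, ← Real.rpow_mul hκ.le, ← mul_assoc, ← Real.rpow_add hκ,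
      ← add_sub_assoc]
    exact rpow_mul_exp_le_Gamma hκ hk
  rw [norm_div, norm_pow, Real.norm_eq_abs, Real.norm_of_nonneg
    (Real.Gamma_pos_of_pos (zero_lt_one.trans_le hk)).le, div_pow, ← div_eq_mul_inv, div_div]
  gcongr

theorem multichoose_le_two_pow (d k : ℕ) : d.multichoose k ≤ 2 ^ (d + k) := by
  rw [Nat.multichoose_eq]
  exact (Nat.choose_le_two_pow _ _).trans (Nat.pow_le_pow_right two_pos (Nat.sub_le _ _))

theorem summable_multichoose_mul_pow_div_Gamma (hα : 0 < α) (d : ℕ) (γ x : ℝ) :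
    Summable fun k : ℕ => (d.multichoose k : ℝ) * (x ^ k / Real.Gamma (α * k + γ)) := by
  refine .of_norm_bounded ((summable_pow_div_Gamma hα γ (2 * x)).norm.mul_left (2 ^ d)) fun k => ?_
  have hle : (d.multichoose k : ℝ) ≤ 2 ^ d * 2 ^ k := by
    exact_mod_cast pow_add 2 d k ▸ multichoose_le_two_pow d k
  calc ‖(d.multichoose k : ℝ) * (x ^ k / Real.Gamma (α * k + γ))‖
      ≤ 2 ^ d * 2 ^ k * ‖x ^ k / Real.Gamma (α * k + γ)‖ := by
        rw [norm_mul, RCLike.norm_natCast]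
        gcongr
    _ = 2 ^ d * ‖(2 * x) ^ k / Real.Gamma (α * k + γ)‖ := by
        simp only [norm_div, norm_pow, norm_mul, Real.norm_two]
        ring

theorem mittagLeffler_natCast {d : ℕ} (hd : 0 < d) (α γ w : ℝ) :
    mittagLeffler d α γ w = ∑' k : ℕ, (d.multichoose k : ℝ) * (w ^ k / Real.Gamma (α * k + γ)) := by
  obtain ⟨e, rfl⟩ := Nat.exists_eq_add_of_le' hd
  refine tsum_congr fun k => ?_
  have hfactorial : (((e + 1).multichoose k : ℕ) : ℝ) * k.factorial * e.factorial =
      (e + k).factorial := by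
    rw [Nat.multichoose_eq, Nat.add_right_comm, Nat.add_sub_cancel, mul_right_comm]
    exact_mod_cast Nat.add_choose_mul_factorial_mul_factorial e k
  have hGamma : Real.Gamma (((e + 1 : ℕ) : ℝ) + k) = (e + k).factorial := by
    rw [← Real.Gamma_nat_eq_factorial]
    push_cast
    ring_nf
  rw [hGamma, ← hfactorial, Nat.cast_succ, Real.Gamma_nat_eq_factorial]
  field_simp

theorem mittagLeffler_one_eq_tsum (α γ w : ℝ) :
    mittagLeffler 1 α γ w = ∑' k : ℕ, w ^ k / Real.Gamma (α * k + γ) := by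
  simpa using mittagLeffler_natCast one_pos α γ w

theorem mittagLeffler_one_eq_one_add (hα : 0 < α) (w : ℝ) :
    mittagLeffler 1 α 1 w = 1 + w * mittagLeffler 1 α (α + 1) w := by
  rw [mittagLeffler_one_eq_tsum, mittagLeffler_one_eq_tsum,
    (summable_pow_div_Gamma hα 1 w).tsum_eq_zero_add, ← tsum_mul_left]
  congr 1
  · simp
  · refine tsum_congr fun k => ?_
    rw [pow_succ', mul_div_assoc, Nat.cast_succ, mul_add_one, add_assoc]

theorem monotoneOn_mittagLeffler_one {γ : ℝ} (hα : 0 < α) (hγ : 0 ≤ γ) :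
    MonotoneOn (mittagLeffler 1 α γ) (Ici 0) := by
  intro w hw x _ hwx
  rw [mittagLeffler_one_eq_tsum, mittagLeffler_one_eq_tsum]
  refine (summable_pow_div_Gamma hα γ w).tsum_le_tsum (fun k => ?_) (summable_pow_div_Gamma hα γ x)
  have := Real.Gamma_nonneg_of_nonneg (s := α * k + γ) (by positivity)
  gcongr

end MittagLeffler

theorem MeasurableLocallyBounded.abs {f : ℝ → ℝ} (hf : MeasurableLocallyBounded f) :
    MeasurableLocallyBounded |f| :=
  ⟨hf.measurable.norm, fun T => by simpa only [Pi.abs_apply, abs_abs] using hf.bounded T⟩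

/-- The binomial series of `(1 - c J^α)^(-d) J^γ f`. For `d = 1` and `γ = 0` it is the solution `v`
of the fractional linear equation `v = f + c J^α v`. -/
noncomputable def fracResolvent (α c : ℝ) (d : ℕ) (γ : ℝ) (f : ℝ → ℝ) (t : ℝ) : ℝ :=
  ∑' k : ℕ, (d.multichoose k : ℝ) * (c ^ k * fracIntegral (α * k + γ) f t)

section Resolvent

variable {α γ t : ℝ}

theorem rpow_mul_natCast_add (hα : 0 ≤ α) (hγ : 0 ≤ γ) (ht : 0 ≤ t) (k : ℕ) :
    t ^ (α * k + γ) = (t ^ α) ^ k * t ^ γ := by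
  rw [Real.rpow_add_of_nonneg ht (by positivity) hγ, Real.rpow_mul ht, Real.rpow_natCast]

theorem MeasurableLocallyBounded.summable_multichoose_mul_fracIntegral {f : ℝ → ℝ}
    (hf : MeasurableLocallyBounded f) (hα : 0 < α) (hγ : 0 ≤ γ) (ht : 0 ≤ t) (c : ℝ) (d : ℕ) :
    Summable fun k : ℕ => (d.multichoose k : ℝ) * (c ^ k * fracIntegral (α * k + γ) f t) := by
  obtain ⟨C, hC⟩ := hf.bounded t
  refine .of_norm_bounded ((summable_multichoose_mul_pow_div_Gamma hα d (γ + 1)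
    (|c| * t ^ α)).mul_left (C * t ^ γ)) fun k => ?_
  rw [norm_mul, norm_mul, norm_pow, RCLike.norm_natCast, Real.norm_eq_abs, Real.norm_eq_abs]
  calc (d.multichoose k : ℝ) * (|c| ^ k * |fracIntegral (α * k + γ) f t|)
      ≤ d.multichoose k * (|c| ^ k * (C * (t ^ (α * k + γ) / Real.Gamma (α * k + γ + 1)))) := by
        gcongr
        exact hf.abs_fracIntegral_le (by positivity) ht hC
    _ = _ := by
        rw [rpow_mul_natCast_add hα.le hγ ht, add_assoc]
        ring

theorem fracIntegral_eq_setIntegral {β : ℝ} (hβ : 0 < β) (f : ℝ → ℝ) (ht : 0 ≤ t) :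
    fracIntegral β f t =
      ∫ u in Ioo 0 t, (Real.Gamma β)⁻¹ * ((t - u) ^ (β - 1) * f u) := by
  rw [fracIntegral_of_pos hβ, intervalIntegral.integral_of_le ht, integral_Ioc_eq_integral_Ioo,
    integral_const_mul]

theorem fracIntegral_abs_eq_integral_norm {β : ℝ} (hβ : 0 < β) (f : ℝ → ℝ) (ht : 0 ≤ t) :
    fracIntegral β |f| t =
      ∫ u in Ioo 0 t, ‖(Real.Gamma β)⁻¹ * ((t - u) ^ (β - 1) * f u)‖ := by
  rw [fracIntegral_eq_setIntegral hβ _ ht]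
  refine setIntegral_congr_fun measurableSet_Ioo fun u hu => ?_
  simp only [norm_mul, norm_inv, Real.norm_eq_abs, Pi.abs_apply,
    abs_of_pos (Real.Gamma_pos_of_pos hβ),
    abs_of_nonneg (Real.rpow_nonneg (sub_nonneg.2 hu.2.le) _)]

theorem fracResolvent_zero (α c γ : ℝ) (f : ℝ → ℝ) :
    fracResolvent α c 0 γ f = fracIntegral γ f := by
  funext t
  rw [fracResolvent, tsum_eq_single 0 fun k hk => ?_]
  · simp
  · obtain ⟨k, rfl⟩ := Nat.exists_eq_succ_of_ne_zero hk
    simp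

theorem fracResolvent_smul (α c : ℝ) (d : ℕ) (γ b : ℝ) (f : ℝ → ℝ) :
    fracResolvent α c d γ (b • f) = b • fracResolvent α c d γ f := by
  funext t
  simp only [fracResolvent, fracIntegral_smul, Pi.smul_apply, smul_eq_mul, ← tsum_mul_left,
    mul_left_comm b]

namespace MeasurableLocallyBounded

variable {f g : ℝ → ℝ}

theorem fracResolvent_add (hf : MeasurableLocallyBounded f) (hg : MeasurableLocallyBounded g)
    (hα : 0 < α) (hγ : 0 ≤ γ) (ht : 0 ≤ t) (c : ℝ) (d : ℕ) :
    fracResolvent α c d γ (f + g) t = fracResolvent α c d γ f t + fracResolvent α c d γ g t := by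
  unfold fracResolvent
  rw [← (hf.summable_multichoose_mul_fracIntegral hα hγ ht c d).tsum_add
    (hg.summable_multichoose_mul_fracIntegral hα hγ ht c d)]
  refine tsum_congr fun k => ?_
  rw [hf.fracIntegral_add hg (by positivity) ht]
  ring

theorem fracResolvent_mono (hf : MeasurableLocallyBounded f) (hg : MeasurableLocallyBounded g)
    (hα : 0 < α) (hγ : 0 ≤ γ) (ht : 0 ≤ t) {c : ℝ} (hc : 0 ≤ c) (d : ℕ)
    (h : ∀ s ∈ Icc 0 t, f s ≤ g s) :
    fracResolvent α c d γ f t ≤ fracResolvent α c d γ g t := by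
  refine (hf.summable_multichoose_mul_fracIntegral hα hγ ht c d).tsum_le_tsum (fun k => ?_)
    (hg.summable_multichoose_mul_fracIntegral hα hγ ht c d)
  gcongr
  exact hf.fracIntegral_mono hg (by positivity) ht h

theorem fracResolvent_fracIntegral (hf : MeasurableLocallyBounded f) (hα : 0 ≤ α) (hγ : 0 ≤ γ)
    {β : ℝ} (hβ : 0 ≤ β) (ht : 0 ≤ t) (c : ℝ) (d : ℕ) :
    fracResolvent α c d γ (fracIntegral β f) t = fracResolvent α c d (γ + β) f t := by
  refine tsum_congr fun k => ?_
  rw [hf.fracIntegral_fracIntegral (by positivity) hβ ht, add_assoc]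

theorem fracResolvent_add_fracIntegral_add_smul {q : ℝ → ℝ} (hf : MeasurableLocallyBounded f)
    (hg : MeasurableLocallyBounded g) (hq : MeasurableLocallyBounded q) (hα : 0 < α) (hγ : 0 ≤ γ)
    {β : ℝ} (hβ : 0 ≤ β) (ht : 0 ≤ t) (c : ℝ) (d : ℕ) (b : ℝ) :
    fracResolvent α c d γ (f + fracIntegral β (g + b • q)) t =
      fracResolvent α c d γ (f + fracIntegral β g) t + b * fracResolvent α c d (γ + β) q t := by
  have hgq := hg.add (hq.const_smul b)
  rw [hf.fracResolvent_add (hgq.fracIntegral hβ) hα hγ ht,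
    hf.fracResolvent_add (hg.fracIntegral hβ) hα hγ ht,
    hgq.fracResolvent_fracIntegral hα.le hγ hβ ht, hg.fracResolvent_fracIntegral hα.le hγ hβ ht,
    hg.fracResolvent_add (hq.const_smul b) hα (by positivity) ht, fracResolvent_smul,
    Pi.smul_apply, smul_eq_mul, add_assoc]

theorem fracResolvent_succ_of_eq {v : ℝ → ℝ} (hg : MeasurableLocallyBounded g)
    (hv : MeasurableLocallyBounded v) (hα : 0 < α) (hγ : 0 ≤ γ) (ht : 0 ≤ t) {c : ℝ}
    (h : EqOn v (g + c • fracIntegral α v) (Ici 0)) (d : ℕ) :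
    fracResolvent α c (d + 1) γ g t = fracResolvent α c d γ v t := by
  set a : ℕ → ℝ := fun k => c ^ k * fracIntegral (α * k + γ) v t
  have ha : ∀ k : ℕ, c ^ k * fracIntegral (α * k + γ) g t = a k - a (k + 1) := fun k => by
    have hβ : 0 ≤ α * k + γ := by positivity
    have hshift : α * k + γ + α = α * (k + 1 : ℕ) + γ := by push_cast; ring
    have hiter : fracIntegral (α * k + γ) v t = fracIntegral (α * k + γ) g t
        + c * fracIntegral (α * (k + 1 : ℕ) + γ) v t := by
      rw [fracIntegral_congr ht (h.mono Icc_subset_Ici_self),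
        hg.fracIntegral_add ((hv.fracIntegral hα.le).const_smul c) hβ ht, fracIntegral_smul,
        Pi.smul_apply, hv.fracIntegral_fracIntegral hβ hα.le ht, hshift, smul_eq_mul]
    simp only [a, hiter, pow_succ]
    ring
  have hsum : Summable fun k => ((d + 1).multichoose k : ℝ) * a k :=
    hv.summable_multichoose_mul_fracIntegral hα hγ ht c (d + 1)
  have hsum' : Summable fun k => ((d + 1).multichoose k : ℝ) * a (k + 1) :=
    (hsum.sub (hg.summable_multichoose_mul_fracIntegral hα hγ ht c (d + 1))).congr fun k => by
      rw [ha]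
      ring
  have hsum₀ : Summable fun k => (d.multichoose k : ℝ) * a k :=
    hv.summable_multichoose_mul_fracIntegral hα hγ ht c d
  calc fracResolvent α c (d + 1) γ g t
      = ∑' k, (((d + 1).multichoose k : ℝ) * a k - (d + 1).multichoose k * a (k + 1)) :=
        tsum_congr fun k => by rw [ha, mul_sub]
    _ = a 0 + ∑' k, (d.multichoose (k + 1) : ℝ) * a (k + 1) := by
        rw [hsum.tsum_sub hsum', hsum.tsum_eq_zero_add, add_sub_assoc,
          ← ((summable_nat_add_iff 1).2 hsum).tsum_sub hsum']
        simp [Nat.multichoose_succ_succ, add_mul]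
    _ = fracResolvent α c d γ v t := by
        rw [fracResolvent, hsum₀.tsum_eq_zero_add]
        simp [a]

theorem eq_fracResolvent_of_eq {v : ℝ → ℝ} (hg : MeasurableLocallyBounded g)
    (hv : MeasurableLocallyBounded v) (hα : 0 < α) (ht : 0 ≤ t) {c : ℝ}
    (h : EqOn v (g + c • fracIntegral α v) (Ici 0)) : v t = fracResolvent α c 1 0 g t := by
  rw [hg.fracResolvent_succ_of_eq hv hα le_rfl ht h, fracResolvent_zero, fracIntegral_zero]

theorem le_fracResolvent_of_le (hf : MeasurableLocallyBounded f)
    (hg : MeasurableLocallyBounded g) (hα : 0 < α) (ht : 0 ≤ t) {c : ℝ} (hc : 0 ≤ c)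
    (h : ∀ s ∈ Icc 0 t, f s ≤ g s + c * fracIntegral α f s) :
    f t ≤ fracResolvent α c 1 0 g t := by
  have hdiff : MeasurableLocallyBounded (f + -c • fracIntegral α f) :=
    hf.add ((hf.fracIntegral hα.le).const_smul (-c))
  rw [hdiff.eq_fracResolvent_of_eq hf hα ht (c := c) fun s _ => by simp]
  refine hdiff.fracResolvent_mono hg hα le_rfl ht hc 1 fun s hs => ?_
  have := h s hs
  simp only [Pi.add_apply, Pi.smul_apply, smul_eq_mul]
  linarith

theorem integrableOn_fracIntegral_integrand (hf : MeasurableLocallyBounded f) {β : ℝ}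
    (hβ : 0 < β) (ht : 0 ≤ t) :
    IntegrableOn (fun u => (Real.Gamma β)⁻¹ * ((t - u) ^ (β - 1) * f u)) (Ioo 0 t) :=
  ((intervalIntegrable_iff_integrableOn_Ioo_of_le ht).1
    (hf.intervalIntegrable_mul (intervalIntegrable_sub_rpow hβ t) ht)).const_mul _

theorem fracResolvent_eq_timeConv (hf : MeasurableLocallyBounded f) (hα : 0 < α) (hγ : 0 < γ)
    (ht : 0 ≤ t) (c : ℝ) {d : ℕ} (hd : 0 < d) :
    fracResolvent α c d γ f t =
      timeConv f (fun s => s ^ (γ - 1) * mittagLeffler d α γ (c * s ^ α)) t := by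
  have hβ : ∀ k : ℕ, 0 < α * k + γ := fun k => by positivity
  let F : ℕ → ℝ → ℝ := fun k u => d.multichoose k * (c ^ k *
    ((Real.Gamma (α * k + γ))⁻¹ * ((t - u) ^ (α * k + γ - 1) * f u)))
  have hF : ∀ k, IntegrableOn (F k) (Ioo 0 t) := fun k =>
    ((hf.integrableOn_fracIntegral_integrand (hβ k) ht).const_mul _).const_mul _
  have hterm : ∀ k, ∫ u in Ioo 0 t, F k u =
      d.multichoose k * (c ^ k * fracIntegral (α * k + γ) f t) := fun k => by
    rw [fracIntegral_eq_setIntegral (hβ k) f ht, ← integral_const_mul, ← integral_const_mul]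
  have hnorm : ∀ k, ∫ u in Ioo 0 t, ‖F k u‖ =
      d.multichoose k * (|c| ^ k * fracIntegral (α * k + γ) |f| t) := fun k => by
    simp only [F, norm_mul _ (_ * _), integral_const_mul, norm_pow, RCLike.norm_natCast,
      Real.norm_eq_abs c, fracIntegral_abs_eq_integral_norm (hβ k) f ht]
  have hsum : Summable fun k => ∫ u in Ioo 0 t, ‖F k u‖ := by
    simp only [hnorm]
    exact hf.abs.summable_multichoose_mul_fracIntegral hα hγ.le ht |c| d
  simp only [fracResolvent, ← hterm]
  rw [integral_tsum_of_summable_integral_norm hF hsum, timeConv,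
    intervalIntegral.integral_of_le ht, integral_Ioc_eq_integral_Ioo]
  refine setIntegral_congr_fun measurableSet_Ioo fun u hu => ?_
  simp only [F, mittagLeffler_natCast hd, ← tsum_mul_left]
  refine tsum_congr fun k => ?_
  have htu : 0 < t - u := sub_pos.2 hu.2
  rw [add_sub_assoc, Real.rpow_add htu, Real.rpow_mul htu.le, Real.rpow_natCast, mul_pow]
  ring

end MeasurableLocallyBounded

theorem fracResolvent_const (hα : 0 ≤ α) (hγ : 0 ≤ γ) (ht : 0 ≤ t) (c : ℝ) {d : ℕ} (hd : 0 < d)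
    (b : ℝ) : fracResolvent α c d γ (fun _ => b) t =
      b * (t ^ γ * mittagLeffler d α (γ + 1) (c * t ^ α)) := by
  rw [mittagLeffler_natCast hd, ← tsum_mul_left, ← tsum_mul_left]
  refine tsum_congr fun k => ?_
  rw [fracIntegral_const (by positivity), rpow_mul_natCast_add hα hγ ht, add_assoc]
  ring

theorem MeasurableLocallyBounded.fracResolvent_affine {p : ℝ → ℝ}
    (hp : MeasurableLocallyBounded p) (hα : 0 < α) (hγ : 0 ≤ γ) (ht : 0 ≤ t) (c : ℝ) {d : ℕ}
    (hd : 0 < d) (a b b' : ℝ) :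
    fracResolvent α c d γ ((fun _ => a) + fracIntegral α ((fun _ => b) + b' • p)) t =
      a * (t ^ γ * mittagLeffler d α (γ + 1) (c * t ^ α))
        + b * (t ^ (γ + α) * mittagLeffler d α (γ + α + 1) (c * t ^ α))
        + b' * fracResolvent α c d (γ + α) p t := by
  rw [(const a).fracResolvent_add_fracIntegral_add_smul (const b) hp hα hγ hα.le ht,
    (const a).fracResolvent_add ((const b).fracIntegral hα.le) hα hγ ht,
    (const b).fracResolvent_fracIntegral hα.le hγ hα.le ht,
    fracResolvent_const hα.le hγ ht c hd, fracResolvent_const hα.le (by positivity) ht c hd]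

end Resolvent

/-- The mean at time `t` of the observable `φ`, for the family of state distributions `ν`. -/
noncomputable def stateMean (ν : Kernel ℝ≥0 ℕ) (φ : ℕ → ℝ) (t : ℝ) : ℝ :=
  ∫ n, φ n ∂ν t.toNNReal

/-- The generator of the queue acting on observables: arrivals at rate `lam`, services at rate `μ`,
catastrophes at rate `ξ`. No service takes place in state `0`: there truncated subtraction makes the
service term vanish. -/
def queueGenerator (lam μ ξ : ℝ) : (ℕ → ℝ) →ₗ[ℝ] (ℕ → ℝ) where
  toFun φ n := lam * (φ (n + 1) - φ n) + μ * (φ (n - 1) - φ n) + ξ * (φ 0 - φ n)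
  map_add' φ ψ := by
    funext n
    simp only [Pi.add_apply]
    ring
  map_smul' c φ := by
    funext n
    simp only [Pi.smul_apply, smul_eq_mul, RingHom.id_apply]
    ring

/-- The fractional Dynkin formula `E[φ(X_t)] = φ(i) + J^α E[(Lφ)(X)](t)` for the observable `φ`,
together with the integrability that makes it meaningful. -/
structure DynkinFormula (ν : Kernel ℝ≥0 ℕ) (L : (ℕ → ℝ) →ₗ[ℝ] (ℕ → ℝ)) (α : ℝ) (i : ℕ)
    (φ : ℕ → ℝ) : Prop where
  integrable : ∀ t, Integrable φ (ν t)
  integrable_map : ∀ t, Integrable (L φ) (ν t)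
  measurableLocallyBounded : MeasurableLocallyBounded (stateMean ν (L φ))
  stateMean_eq : ∀ t, 0 ≤ t → stateMean ν φ t = φ i + fracIntegral α (stateMean ν (L φ)) t

section StateMean

variable {ν : Kernel ℝ≥0 ℕ} {φ ψ V : ℕ → ℝ}

theorem measurable_stateMean (ν : Kernel ℝ≥0 ℕ) (φ : ℕ → ℝ) : Measurable (stateMean ν φ) :=
  (StronglyMeasurable.of_discrete (f := φ)).integral_kernel.measurable.comp measurable_real_toNNReal

theorem stateMean_add {t : ℝ} (hφ : Integrable φ (ν t.toNNReal))
    (hψ : Integrable ψ (ν t.toNNReal)) :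
    stateMean ν (φ + ψ) t = stateMean ν φ t + stateMean ν ψ t :=
  integral_add hφ hψ

theorem stateMean_smul (c : ℝ) (φ : ℕ → ℝ) : stateMean ν (c • φ) = c • stateMean ν φ :=
  funext fun _ => integral_smul c φ

theorem stateMean_const [IsMarkovKernel ν] (c t : ℝ) : stateMean ν (fun _ => c) t = c := by
  simp [stateMean]

theorem abs_stateMean_le {K t : ℝ} (hV : Integrable V (ν t.toNNReal)) (h : ∀ n, |φ n| ≤ K * V n) :
    |stateMean ν φ t| ≤ K * stateMean ν V t := by
  rw [stateMean, stateMean, ← integral_const_mul]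
  exact norm_integral_le_of_norm_le (f := φ) (hV.const_mul K) (ae_of_all _ h)

theorem integrable_of_abs_le {m : Measure ℕ} {K : ℝ} (hV : Integrable V m)
    (h : ∀ n, |φ n| ≤ K * V n) : Integrable φ m :=
  (hV.const_mul K).mono' .of_discrete (ae_of_all _ h)

end StateMean

namespace DynkinFormula

variable {ν : Kernel ℝ≥0 ℕ} {L : (ℕ → ℝ) →ₗ[ℝ] (ℕ → ℝ)} {α : ℝ} {i : ℕ} {φ ψ : ℕ → ℝ}

theorem add (hα : 0 ≤ α) (hφ : DynkinFormula ν L α i φ) (hψ : DynkinFormula ν L α i ψ) :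
    DynkinFormula ν L α i (φ + ψ) := by
  have hmean : stateMean ν (L (φ + ψ)) = stateMean ν (L φ) + stateMean ν (L ψ) := by
    rw [map_add]
    exact funext fun t => stateMean_add (hφ.integrable_map _) (hψ.integrable_map _)
  have hmlb := hφ.measurableLocallyBounded.add hψ.measurableLocallyBounded
  refine ⟨fun t => (hφ.integrable t).add (hψ.integrable t), fun t => ?_, hmean ▸ hmlb,
    fun t ht => ?_⟩
  · rw [map_add]
    exact (hφ.integrable_map t).add (hψ.integrable_map t)
  · rw [stateMean_add (hφ.integrable _) (hψ.integrable _), hφ.stateMean_eq t ht,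
      hψ.stateMean_eq t ht, hmean,
      hφ.measurableLocallyBounded.fracIntegral_add hψ.measurableLocallyBounded hα ht, Pi.add_apply]
    ring

theorem const_smul (c : ℝ) (hφ : DynkinFormula ν L α i φ) : DynkinFormula ν L α i (c • φ) := by
  refine ⟨fun t => (hφ.integrable t).smul c, fun t => ?_, ?_, fun t ht => ?_⟩
  · rw [map_smul]
    exact (hφ.integrable_map t).smul c
  · rw [map_smul, stateMean_smul]
    exact hφ.measurableLocallyBounded.const_smul c
  · rw [map_smul, stateMean_smul, stateMean_smul, fracIntegral_smul, Pi.smul_apply,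
      hφ.stateMean_eq t ht, Pi.smul_apply, Pi.smul_apply, smul_add]

theorem const [IsMarkovKernel ν] (hL : L 1 = 0) (hα : 0 ≤ α) (c : ℝ) :
    DynkinFormula ν L α i fun _ => c := by
  have hc : (fun _ => c) = c • (1 : ℕ → ℝ) := by
    funext n
    simp
  have hmean : stateMean ν (L fun _ => c) = fun _ => 0 := by
    rw [hc, map_smul, hL, smul_zero]
    exact funext fun t => stateMean_const 0 t
  refine ⟨fun t => integrable_const c, fun t => ?_, hmean ▸ .const 0, fun t _ => ?_⟩
  · rw [hc, map_smul, hL, smul_zero]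
    exact integrable_zero _ _ _
  · rw [hmean, stateMean_const, fracIntegral_const hα, zero_mul, add_zero]

theorem comp_min [IsMarkovKernel ν] (hL : L 1 = 0) (hα : 0 ≤ α)
    (h : ∀ n, DynkinFormula ν L α i (Pi.single n 1)) (φ : ℕ → ℝ) (N : ℕ) :
    DynkinFormula ν L α i fun n => φ (min n N) := by
  have hdecomp : (fun n => φ (min n N)) =
      (fun _ => φ N) + ∑ k ∈ Finset.range N, (φ k - φ N) • (Pi.single k 1 : ℕ → ℝ) := by
    funext n
    have hsum : ∑ k ∈ Finset.range N, (φ k - φ N) * (Pi.single k 1 : ℕ → ℝ) n =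
        if n < N then φ n - φ N else 0 := by
      simp [Pi.single_apply]
    simp only [Pi.add_apply, Finset.sum_apply, Pi.smul_apply, smul_eq_mul, hsum]
    split_ifs with hn
    · simp [hn.le]
    · simp [not_lt.1 hn]
  rw [hdecomp]
  refine (const hL hα (φ N)).add hα ?_
  exact Finset.sum_induction _ _ (fun _ _ => add hα) (const hL hα 0) fun k _ =>
    (h k).const_smul (φ k - φ N)

end DynkinFormula

theorem queueGenerator_one (lam μ ξ : ℝ) : queueGenerator lam μ ξ 1 = 0 := by
  funext n
  simp [queueGenerator]

/-- A weight on the states with at most exponential growth: a Lyapunov function for the queue. -/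
structure GrowthWeight (c : ℝ) (V : ℕ → ℝ) : Prop where
  rate_nonneg : 0 ≤ c
  nonneg : ∀ n, 0 ≤ V n
  mono : Monotone V
  growth : ∀ n, V (n + 1) - V n ≤ c * V n

section Truncation

variable {V : ℕ → ℝ}

theorem tendsto_comp_min (φ : ℕ → ℝ) (n : ℕ) :
    Filter.Tendsto (fun N => φ (min n N)) Filter.atTop (nhds (φ n)) :=
  tendsto_const_nhds.congr' <| (Filter.eventually_ge_atTop n).mono fun N hN => by
    simp only [min_eq_left hN]

theorem integrable_of_integral_comp_min_le {m : Measure ℕ} (hV₀ : ∀ n, 0 ≤ V n)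
    (hV : Monotone V) {B : ℝ} (hint : ∀ N, Integrable (fun n => V (min n N)) m)
    (hB : ∀ N, ∫ n, V (min n N) ∂m ≤ B) : Integrable V m := by
  refine ⟨.of_discrete, (hasFiniteIntegral_iff_ofReal (ae_of_all _ hV₀)).2 ?_⟩
  have hlim := lintegral_tendsto_of_tendsto_of_monotone (μ := m)
    (f := fun N n => ENNReal.ofReal (V (min n N))) (fun _ => .of_discrete)
    (ae_of_all _ fun n _ _ h => ENNReal.ofReal_le_ofReal (hV (min_le_min_left n h)))
    (ae_of_all _ fun n => (ENNReal.continuous_ofReal.tendsto _).comp (tendsto_comp_min V n))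
  refine (le_of_tendsto' hlim fun N => ?_).trans_lt (ENNReal.ofReal_lt_top (r := B))
  rw [← ofReal_integral_eq_lintegral_ofReal (hint N) (ae_of_all _ fun n => hV₀ _)]
  exact ENNReal.ofReal_le_ofReal (hB N)

theorem tendsto_integral_comp_min {m : Measure ℕ} (hV : Monotone V)
    (hint : ∀ N, Integrable (fun n => V (min n N)) m) (hint' : Integrable V m) :
    Filter.Tendsto (fun N => ∫ n, V (min n N) ∂m) Filter.atTop (nhds (∫ n, V n ∂m)) :=
  integral_tendsto_of_tendsto_of_monotone hint hint'
    (ae_of_all _ fun n _ _ h => hV (min_le_min_left n h)) (ae_of_all _ (tendsto_comp_min V))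

end Truncation

theorem tendsto_stateMean_of_abs_le {ν : Kernel ℝ≥0 ℕ} {φ V : ℕ → ℝ} {F : ℕ → ℕ → ℝ} {K t : ℝ}
    (hV : Integrable V (ν t.toNNReal)) (hF : ∀ N n, |F N n| ≤ K * V n)
    (hlim : ∀ n, Filter.Tendsto (F · n) Filter.atTop (nhds (φ n))) :
    Filter.Tendsto (fun N => stateMean ν (F N) t) Filter.atTop (nhds (stateMean ν φ t)) :=
  tendsto_integral_of_dominated_convergence _ (fun _ => .of_discrete) (hV.const_mul K)
    (fun N => ae_of_all _ (hF N)) (ae_of_all _ hlim)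

theorem tendsto_queueGenerator_comp_min (lam μ ξ : ℝ) (φ : ℕ → ℝ) (n : ℕ) :
    Filter.Tendsto (fun N => queueGenerator lam μ ξ (fun n => φ (min n N)) n) Filter.atTop
      (nhds (queueGenerator lam μ ξ φ n)) :=
  have hjump (r : ℝ) (m : ℕ) :=
    ((tendsto_comp_min φ m).sub (tendsto_comp_min φ n)).const_mul r
  ((hjump lam (n + 1)).add (hjump μ (n - 1))).add (hjump ξ 0)

/-- The forward equations of the queue started in `i`, in integrated form: the Dynkin formula holds
for the indicator of every state. -/
def SolvesForward (ν : Kernel ℝ≥0 ℕ) (α lam μ ξ : ℝ) (i : ℕ) : Prop :=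
  ∀ n, DynkinFormula ν (queueGenerator lam μ ξ) α i (Pi.single n 1)

namespace GrowthWeight

variable {c : ℝ} {V : ℕ → ℝ} {lam μ ξ : ℝ}

theorem queueGenerator_comp_min_le (hV : GrowthWeight c V) (hlam : 0 ≤ lam) (hμ : 0 ≤ μ)
    (hξ : 0 ≤ ξ) (N n : ℕ) :
    queueGenerator lam μ ξ (fun n => V (min n N)) n ≤ lam * c * V (min n N) := by
  have harrival : V (min (n + 1) N) - V (min n N) ≤ c * V (min n N) := by
    rcases lt_or_ge n N with hn | hn
    · rw [min_eq_left hn, min_eq_left hn.le]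
      exact hV.growth n
    · rw [min_eq_right hn, min_eq_right (by lia), sub_self]
      exact mul_nonneg hV.rate_nonneg (hV.nonneg N)
  have hservice : V (min (n - 1) N) ≤ V (min n N) := hV.mono (min_le_min_right N (Nat.sub_le n 1))
  have hcatastrophe : V (min 0 N) ≤ V (min n N) := hV.mono (min_le_min_right N n.zero_le)
  have h₁ := mul_le_mul_of_nonneg_left harrival hlam
  have h₂ := mul_nonneg hμ (sub_nonneg.2 hservice)
  have h₃ := mul_nonneg hξ (sub_nonneg.2 hcatastrophe)
  simp only [queueGenerator, LinearMap.coe_mk, AddHom.coe_mk]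
  linarith

theorem abs_queueGenerator_le (hV : GrowthWeight c V) (hlam : 0 ≤ lam) (hμ : 0 ≤ μ)
    (hξ : 0 ≤ ξ) {φ : ℕ → ℝ} {C : ℝ} (hC : 0 ≤ C) (hφ : ∀ n, |φ n| ≤ C * V n) (n : ℕ) :
    |queueGenerator lam μ ξ φ n| ≤ (lam * (2 + c) + 2 * μ + 2 * ξ) * C * V n := by
  have hle : ∀ m, m ≤ n → |φ m| ≤ C * V n := fun m hm =>
    (hφ m).trans (mul_le_mul_of_nonneg_left (hV.mono hm) hC)
  have hsucc : |φ (n + 1)| ≤ C * ((1 + c) * V n) :=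
    (hφ (n + 1)).trans (mul_le_mul_of_nonneg_left (by linarith [hV.growth n]) hC)
  have hjump : ∀ {r : ℝ} (m : ℕ), 0 ≤ r → |r * (φ m - φ n)| ≤ r * (|φ m| + C * V n) :=
    fun {r} m hr => by
      rw [abs_mul, abs_of_nonneg hr]
      exact mul_le_mul_of_nonneg_left ((abs_sub _ _).trans (add_le_add_right (hφ n) _)) hr
  calc |queueGenerator lam μ ξ φ n|
      ≤ lam * (|φ (n + 1)| + C * V n) + μ * (|φ (n - 1)| + C * V n) + ξ * (|φ 0| + C * V n) :=
        (abs_add_three _ _ _).trans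
          (add_le_add_three (hjump _ hlam) (hjump _ hμ) (hjump _ hξ))
    _ ≤ lam * (C * ((1 + c) * V n) + C * V n) + μ * (C * V n + C * V n)
          + ξ * (C * V n + C * V n) := by
        gcongr
        exacts [hle _ (Nat.sub_le n 1), hle 0 n.zero_le]
    _ = (lam * (2 + c) + 2 * μ + 2 * ξ) * C * V n := by ring

end GrowthWeight

namespace SolvesForward

variable {ν : Kernel ℝ≥0 ℕ} [IsMarkovKernel ν] {α lam μ ξ c t : ℝ} {i : ℕ} {V φ : ℕ → ℝ}

theorem dynkinFormula_comp_min (h : SolvesForward ν α lam μ ξ i) (hα : 0 ≤ α) (φ : ℕ → ℝ)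
    (N : ℕ) : DynkinFormula ν (queueGenerator lam μ ξ) α i fun n => φ (min n N) :=
  .comp_min (queueGenerator_one lam μ ξ) hα h φ N

theorem stateMean_comp_min_le (h : SolvesForward ν α lam μ ξ i) (hV : GrowthWeight c V)
    (hα : 0 < α) (hlam : 0 ≤ lam) (hμ : 0 ≤ μ) (hξ : 0 ≤ ξ) (ht : 0 ≤ t) (N : ℕ) :
    stateMean ν (fun n => V (min n N)) t ≤ V i * mittagLeffler 1 α 1 (lam * c * t ^ α) := by
  set VN : ℕ → ℝ := fun n => V (min n N)
  have hN : DynkinFormula ν (queueGenerator lam μ ξ) α i VN := h.dynkinFormula_comp_min hα.le V N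
  have hbdd : ∀ n, |VN n| ≤ V N * 1 := fun n => by
    simpa [VN, abs_of_nonneg (hV.nonneg _)] using hV.mono (min_le_right n N)
  have hmlb : MeasurableLocallyBounded (stateMean ν VN) :=
    ⟨measurable_stateMean ν VN, fun T => ⟨V N * 1, fun s _ => by
      simpa only [stateMean_const] using abs_stateMean_le (ν := ν) (integrable_const 1) hbdd⟩⟩
  have hle : ∀ s ∈ Icc 0 t,
      stateMean ν VN s ≤ V i + lam * c * fracIntegral α (stateMean ν VN) s := fun s hs => by
    have hgen : ∀ r, stateMean ν (queueGenerator lam μ ξ VN) r ≤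
        ((lam * c) • stateMean ν VN) r := fun r => by
      rw [← stateMean_smul]
      exact integral_mono (hN.integrable_map _) ((hN.integrable _).smul _)
        (hV.queueGenerator_comp_min_le hlam hμ hξ N)
    rw [hN.stateMean_eq s hs.1, ← smul_eq_mul, ← Pi.smul_apply, ← fracIntegral_smul]
    exact add_le_add (hV.mono (min_le_left i N)) (hN.measurableLocallyBounded.fracIntegral_mono
      (hmlb.const_smul _) hα.le hs.1 fun r _ => hgen r)
  have hgronwall := hmlb.le_fracResolvent_of_le (.const (V i)) hα ht
    (mul_nonneg hlam hV.rate_nonneg) hle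
  rw [fracResolvent_const hα.le le_rfl ht _ one_pos] at hgronwall
  simpa using hgronwall

variable (h : SolvesForward ν α lam μ ξ i) (hV : GrowthWeight c V) (hα : 0 < α)
  (hlam : 0 ≤ lam) (hμ : 0 ≤ μ) (hξ : 0 ≤ ξ)
include h hV hα hlam hμ hξ

theorem integrable_weight (t : ℝ≥0) : Integrable V (ν t) :=
  integrable_of_integral_comp_min_le hV.nonneg hV.mono
    (fun N => (h.dynkinFormula_comp_min hα.le V N).integrable t) fun N => by
      simpa only [stateMean, Real.toNNReal_coe] using
        h.stateMean_comp_min_le hV hα hlam hμ hξ t.coe_nonneg N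

theorem stateMean_weight_le (ht : 0 ≤ t) :
    stateMean ν V t ≤ V i * mittagLeffler 1 α 1 (lam * c * t ^ α) :=
  le_of_tendsto' (tendsto_integral_comp_min hV.mono
    (fun N => (h.dynkinFormula_comp_min hα.le V N).integrable _)
    (h.integrable_weight hV hα hlam hμ hξ _)) (h.stateMean_comp_min_le hV hα hlam hμ hξ ht)

theorem abs_stateMean_le_of_abs_le {ψ : ℕ → ℝ} {K T : ℝ} (hK : 0 ≤ K)
    (hψ : ∀ n, |ψ n| ≤ K * V n) (ht : t ∈ Icc 0 T) :
    |stateMean ν ψ t| ≤ K * (V i * mittagLeffler 1 α 1 (lam * c * T ^ α)) := by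
  have hrate : 0 ≤ lam * c := mul_nonneg hlam hV.rate_nonneg
  refine (abs_stateMean_le (h.integrable_weight hV hα hlam hμ hξ _) hψ).trans ?_
  refine mul_le_mul_of_nonneg_left ((h.stateMean_weight_le hV hα hlam hμ hξ ht.1).trans ?_) hK
  have := ht.1
  refine mul_le_mul_of_nonneg_left (monotoneOn_mittagLeffler_one hα zero_le_one
    (mem_Ici.2 (by positivity)) (mem_Ici.2 (mul_nonneg hrate ?_)) ?_) (hV.nonneg i)
  · exact Real.rpow_nonneg (ht.1.trans ht.2) α
  · gcongr
    exact ht.2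

theorem measurableLocallyBounded_stateMean {C : ℝ} (hC : 0 ≤ C) (hφ : ∀ n, |φ n| ≤ C * V n) :
    MeasurableLocallyBounded (stateMean ν φ) :=
  ⟨measurable_stateMean ν φ, fun _ => ⟨_, fun _ hs =>
    h.abs_stateMean_le_of_abs_le hV hα hlam hμ hξ hC hφ hs⟩⟩

theorem dynkinFormula_of_abs_le {C : ℝ} (hC : 0 ≤ C) (hφ : ∀ n, |φ n| ≤ C * V n) :
    DynkinFormula ν (queueGenerator lam μ ξ) α i φ := by
  have hVint := h.integrable_weight hV hα hlam hμ hξ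
  have hcoeff : 0 ≤ (lam * (2 + c) + 2 * μ + 2 * ξ) * C := by
    have := hV.rate_nonneg
    positivity
  have hgen := hV.abs_queueGenerator_le hlam hμ hξ hC hφ
  let φN : ℕ → ℕ → ℝ := fun N n => φ (min n N)
  have hN : ∀ N, DynkinFormula ν (queueGenerator lam μ ξ) α i (φN N) :=
    h.dynkinFormula_comp_min hα.le φ
  have hφN : ∀ N n, |φN N n| ≤ C * V n := fun N n =>
    (hφ _).trans (mul_le_mul_of_nonneg_left (hV.mono (min_le_left n N)) hC)
  have hgenN := fun N => hV.abs_queueGenerator_le hlam hμ hξ hC (hφN N)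
  have hlim : ∀ t, Filter.Tendsto (fun N => stateMean ν (φN N) t) Filter.atTop
      (nhds (stateMean ν φ t)) := fun t =>
    tendsto_stateMean_of_abs_le (hVint _) hφN (tendsto_comp_min φ)
  have hlimgen : ∀ t, Filter.Tendsto (fun N => stateMean ν (queueGenerator lam μ ξ (φN N)) t)
      Filter.atTop (nhds (stateMean ν (queueGenerator lam μ ξ φ) t)) := fun t =>
    tendsto_stateMean_of_abs_le (hVint _) hgenN (tendsto_queueGenerator_comp_min lam μ ξ φ)
  refine ⟨fun t => integrable_of_abs_le (hVint t) hφ, fun t => integrable_of_abs_le (hVint t) hgen,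
    h.measurableLocallyBounded_stateMean hV hα hlam hμ hξ hcoeff hgen, fun t ht => ?_⟩
  refine tendsto_nhds_unique (hlim t) ?_
  simp only [fun N => (hN N).stateMean_eq t ht]
  exact (tendsto_comp_min φ i).add (tendsto_fracIntegral hα.le ht
    (fun N => measurable_stateMean _ _) (fun N s hs =>
      h.abs_stateMean_le_of_abs_le hV hα hlam hμ hξ hcoeff (hgenN N) hs) fun s _ => hlimgen s)

end SolvesForward

theorem DynkinFormula.eqOn_stateMean {ν : Kernel ℝ≥0 ℕ} {L : (ℕ → ℝ) →ₗ[ℝ] (ℕ → ℝ)} {α c : ℝ}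
    {i : ℕ} {φ ψ : ℕ → ℝ} (h : DynkinFormula ν L α i φ) (hL : L φ = ψ + c • φ) (hα : 0 ≤ α)
    (hψ : ∀ t, Integrable ψ (ν t)) (hφm : MeasurableLocallyBounded (stateMean ν φ))
    (hψm : MeasurableLocallyBounded (stateMean ν ψ)) :
    EqOn (stateMean ν φ)
      ((fun _ => φ i) + fracIntegral α (stateMean ν ψ) + c • fracIntegral α (stateMean ν φ))
      (Ici 0) := fun t ht => by
  have hmean : stateMean ν (L φ) = stateMean ν ψ + c • stateMean ν φ := by
    rw [hL, ← stateMean_smul]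
    exact funext fun s => stateMean_add (hψ _) ((h.integrable _).smul c)
  rw [h.stateMean_eq t ht, hmean, hψm.fracIntegral_add (hφm.const_smul c) hα ht, fracIntegral_smul,
    ← add_assoc]
  rfl

section Moments

theorem growthWeight_one_add_sq : GrowthWeight 2 fun n => 1 + (n : ℝ) ^ 2 where
  rate_nonneg := zero_le_two
  nonneg n := by positivity
  mono m n hmn := by
    dsimp only
    gcongr
  growth n := by
    push_cast
    nlinarith [sq_nonneg ((n : ℝ) - 1)]

theorem abs_single_zero_le (n : ℕ) : |(Pi.single 0 1 : ℕ → ℝ) n| ≤ 1 * (1 + (n : ℝ) ^ 2) := by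
  cases n with
  | zero => norm_num
  | succ n =>
    rw [Pi.single_eq_of_ne n.succ_ne_zero, abs_zero]
    positivity

theorem abs_natCast_le (n : ℕ) : |(n : ℝ)| ≤ 1 * (1 + (n : ℝ) ^ 2) := by
  rw [Nat.abs_cast]
  nlinarith [sq_nonneg ((n : ℝ) - 1)]

theorem abs_natCast_sq_le (n : ℕ) : |(n : ℝ) ^ 2| ≤ 1 * (1 + (n : ℝ) ^ 2) := by
  rw [abs_of_nonneg (sq_nonneg _)]
  linarith

theorem queueGenerator_natCast (lam μ ξ : ℝ) :
    queueGenerator lam μ ξ (fun n => (n : ℝ)) =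
      ((fun _ => lam - μ) + μ • (Pi.single 0 1 : ℕ → ℝ)) + -ξ • fun n : ℕ => (n : ℝ) := by
  funext n
  cases n <;> simp [queueGenerator]
  ring

theorem queueGenerator_natCast_sq (lam μ ξ : ℝ) :
    queueGenerator lam μ ξ (fun n => (n : ℝ) ^ 2) =
      (((fun _ => lam + μ) + -μ • (Pi.single 0 1 : ℕ → ℝ)) + (2 * (lam - μ)) • fun n : ℕ => (n : ℝ))
        + -ξ • fun n : ℕ => (n : ℝ) ^ 2 := by
  funext n
  cases n <;> simp [queueGenerator]
  ring

end Moments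

namespace SolvesForward

variable {ν : Kernel ℝ≥0 ℕ} [IsMarkovKernel ν] {α lam μ ξ t : ℝ} {i : ℕ}

theorem stateMean_const_add_smul_single (h : SolvesForward ν α lam μ ξ i) (n : ℕ) (a b : ℝ) :
    stateMean ν ((fun _ => a) + b • (Pi.single n 1 : ℕ → ℝ)) =
      (fun _ => a) + b • stateMean ν (Pi.single n 1) := by
  funext s
  rw [stateMean_add (integrable_const a) (((h n).integrable _).smul b), stateMean_const,
    stateMean_smul]
  rfl

variable (h : SolvesForward ν α lam μ ξ i) (hα : 0 < α) (hlam : 0 ≤ lam) (hμ : 0 ≤ μ) (hξ : 0 ≤ ξ)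
include h hα hlam hμ hξ

theorem integrable_natCast (t : ℝ≥0) : Integrable (fun n : ℕ => (n : ℝ)) (ν t) :=
  integrable_of_abs_le (h.integrable_weight growthWeight_one_add_sq hα hlam hμ hξ t) abs_natCast_le

theorem integrable_natCast_sq (t : ℝ≥0) : Integrable (fun n : ℕ => (n : ℝ) ^ 2) (ν t) :=
  integrable_of_abs_le (h.integrable_weight growthWeight_one_add_sq hα hlam hμ hξ t)
    abs_natCast_sq_le

theorem measurableLocallyBounded_stateMean_single_zero :
    MeasurableLocallyBounded (stateMean ν (Pi.single 0 1)) :=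
  h.measurableLocallyBounded_stateMean growthWeight_one_add_sq hα hlam hμ hξ zero_le_one
    abs_single_zero_le

theorem measurableLocallyBounded_stateMean_natCast :
    MeasurableLocallyBounded (stateMean ν fun n => (n : ℝ)) :=
  h.measurableLocallyBounded_stateMean growthWeight_one_add_sq hα hlam hμ hξ zero_le_one
    abs_natCast_le

theorem measurableLocallyBounded_stateMean_natCast_sq :
    MeasurableLocallyBounded (stateMean ν fun n => (n : ℝ) ^ 2) :=
  h.measurableLocallyBounded_stateMean growthWeight_one_add_sq hα hlam hμ hξ zero_le_one
    abs_natCast_sq_le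

theorem eqOn_stateMean_natCast :
    EqOn (stateMean ν fun n => (n : ℝ))
      ((fun _ => (i : ℝ)) + fracIntegral α ((fun _ => lam - μ) + μ • stateMean ν (Pi.single 0 1))
        + -ξ • fracIntegral α (stateMean ν fun n => (n : ℝ))) (Ici 0) := by
  have hp := h.measurableLocallyBounded_stateMean_single_zero hα hlam hμ hξ
  have hdynkin := h.dynkinFormula_of_abs_le growthWeight_one_add_sq hα hlam hμ hξ zero_le_one
    abs_natCast_le
  rw [← h.stateMean_const_add_smul_single]
  refine hdynkin.eqOn_stateMean (queueGenerator_natCast lam μ ξ) hα.le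
    (fun s => (integrable_const _).add (((h 0).integrable s).smul μ))
    (h.measurableLocallyBounded_stateMean_natCast hα hlam hμ hξ) ?_
  rw [h.stateMean_const_add_smul_single]
  exact (MeasurableLocallyBounded.const _).add (hp.const_smul μ)

theorem eqOn_stateMean_natCast_sq :
    EqOn (stateMean ν fun n => (n : ℝ) ^ 2)
      ((fun _ => (i : ℝ) ^ 2)
        + fracIntegral α (((fun _ => lam + μ) + -μ • stateMean ν (Pi.single 0 1))
          + (2 * (lam - μ)) • stateMean ν fun n => (n : ℝ))
        + -ξ • fracIntegral α (stateMean ν fun n => (n : ℝ) ^ 2)) (Ici 0) := by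
  have hp := h.measurableLocallyBounded_stateMean_single_zero hα hlam hμ hξ
  have hm := h.measurableLocallyBounded_stateMean_natCast hα hlam hμ hξ
  have hdynkin := h.dynkinFormula_of_abs_le growthWeight_one_add_sq hα hlam hμ hξ zero_le_one
    abs_natCast_sq_le
  have hint₀ : ∀ s, Integrable ((fun _ => lam + μ) + -μ • (Pi.single 0 1 : ℕ → ℝ)) (ν s) := fun s =>
    (integrable_const _).add (((h 0).integrable s).smul (-μ))
  have hint₁ : ∀ s, Integrable ((2 * (lam - μ)) • fun n : ℕ => (n : ℝ)) (ν s) := fun s =>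
    (h.integrable_natCast hα hlam hμ hξ s).smul _
  have hsource : stateMean ν (((fun _ => lam + μ) + -μ • (Pi.single 0 1 : ℕ → ℝ))
        + (2 * (lam - μ)) • fun n : ℕ => (n : ℝ)) =
      ((fun _ => lam + μ) + -μ • stateMean ν (Pi.single 0 1))
        + (2 * (lam - μ)) • stateMean ν fun n => (n : ℝ) := by
    rw [← h.stateMean_const_add_smul_single, ← stateMean_smul]
    exact funext fun s => stateMean_add (hint₀ _) (hint₁ _)
  rw [← hsource]
  refine hdynkin.eqOn_stateMean (queueGenerator_natCast_sq lam μ ξ) hα.le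
    (fun s => (hint₀ s).add (hint₁ s))
    (h.measurableLocallyBounded_stateMean_natCast_sq hα hlam hμ hξ) ?_
  rw [hsource]
  exact ((MeasurableLocallyBounded.const _).add (hp.const_smul _)).add (hm.const_smul _)

end SolvesForward

theorem MeasurableLocallyBounded.fracResolvent_eq_mlConv {p : ℝ → ℝ}
    (hp : MeasurableLocallyBounded p) {α t : ℝ} (hα : 0 < α) (ht : 0 ≤ t) (ξ : ℝ) {d : ℕ}
    (hd : 0 < d) : fracResolvent α (-ξ) d (d * α) p t = mlConv α ξ d p t :=
  hp.fracResolvent_eq_timeConv hα (by positivity) ht (-ξ) hd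

theorem MeasurableLocallyBounded.fracResolvent_one_affine {p : ℝ → ℝ}
    (hp : MeasurableLocallyBounded p) {α t : ℝ} (hα : 0 < α) (ht : 0 ≤ t) (ξ a b b' : ℝ) :
    fracResolvent α (-ξ) 1 0 ((fun _ => a) + fracIntegral α ((fun _ => b) + b' • p)) t =
      a * mittagLeffler 1 α 1 (-ξ * t ^ α)
        + b * (t ^ α * mittagLeffler 1 α (α + 1) (-ξ * t ^ α)) + b' * mlConv α ξ 1 p t := by
  have hconv := hp.fracResolvent_eq_mlConv hα ht ξ one_pos
  simp only [Nat.cast_one, one_mul] at hconv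
  simpa [hconv] using hp.fracResolvent_affine hα le_rfl ht (-ξ) one_pos a b b'

theorem MeasurableLocallyBounded.fracResolvent_two_affine {p : ℝ → ℝ}
    (hp : MeasurableLocallyBounded p) {α t : ℝ} (hα : 0 < α) (ht : 0 ≤ t) (ξ a b b' : ℝ) :
    fracResolvent α (-ξ) 2 α ((fun _ => a) + fracIntegral α ((fun _ => b) + b' • p)) t =
      a * (t ^ α * mittagLeffler 2 α (α + 1) (-ξ * t ^ α))
        + b * (t ^ (2 * α) * mittagLeffler 2 α (2 * α + 1) (-ξ * t ^ α))
        + b' * mlConv α ξ 2 p t := by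
  have hconv := hp.fracResolvent_eq_mlConv hα ht ξ two_pos
  simp only [Nat.cast_ofNat] at hconv
  simpa [hconv, ← two_mul] using hp.fracResolvent_affine hα hα.le ht (-ξ) two_pos a b b'

namespace SolvesForward

variable {ν : Kernel ℝ≥0 ℕ} [IsMarkovKernel ν] {α lam μ ξ t : ℝ} {i : ℕ}
  (h : SolvesForward ν α lam μ ξ i) (hα : 0 < α) (hlam : 0 ≤ lam) (hμ : 0 ≤ μ) (hξ : 0 ≤ ξ)
include h hα hlam hμ hξ

theorem stateMean_natCast (ht : 0 ≤ t) :
    stateMean ν (fun n => (n : ℝ)) t = i * mittagLeffler 1 α 1 (-ξ * t ^ α)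
      + (lam - μ) * (t ^ α * mittagLeffler 1 α (α + 1) (-ξ * t ^ α))
      + μ * mlConv α ξ 1 (stateMean ν (Pi.single 0 1)) t := by
  have hp := h.measurableLocallyBounded_stateMean_single_zero hα hlam hμ hξ
  have hg := (MeasurableLocallyBounded.const (i : ℝ)).add
    (((MeasurableLocallyBounded.const (lam - μ)).add (hp.const_smul μ)).fracIntegral hα.le)
  rw [hg.eq_fracResolvent_of_eq (h.measurableLocallyBounded_stateMean_natCast hα hlam hμ hξ) hα ht
    (h.eqOn_stateMean_natCast hα hlam hμ hξ), hp.fracResolvent_one_affine hα ht]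

theorem stateMean_natCast_sq (ht : 0 ≤ t) :
    stateMean ν (fun n => (n : ℝ) ^ 2) t = (i : ℝ) ^ 2 * mittagLeffler 1 α 1 (-ξ * t ^ α)
      + (lam + μ) * (t ^ α * mittagLeffler 1 α (α + 1) (-ξ * t ^ α))
      - μ * mlConv α ξ 1 (stateMean ν (Pi.single 0 1)) t
      + 2 * (lam - μ) * (i * (t ^ α * mittagLeffler 2 α (α + 1) (-ξ * t ^ α))
        + (lam - μ) * (t ^ (2 * α) * mittagLeffler 2 α (2 * α + 1) (-ξ * t ^ α))
        + μ * mlConv α ξ 2 (stateMean ν (Pi.single 0 1)) t) := by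
  have hp := h.measurableLocallyBounded_stateMean_single_zero hα hlam hμ hξ
  have hm := h.measurableLocallyBounded_stateMean_natCast hα hlam hμ hξ
  set p₀ := stateMean ν (Pi.single 0 1)
  set m := stateMean ν fun n => (n : ℝ)
  have hsource (a b : ℝ) : MeasurableLocallyBounded ((fun _ => a) + b • p₀) :=
    (MeasurableLocallyBounded.const a).add (hp.const_smul b)
  have hc (a : ℝ) : MeasurableLocallyBounded fun _ => a := .const a
  have hg₁ := (hc i).add ((hsource (lam - μ) μ).fracIntegral hα.le)
  have hg₂ := (hc (i ^ 2)).add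
    (((hsource (lam + μ) (-μ)).add (hm.const_smul (2 * (lam - μ)))).fracIntegral hα.le)
  rw [hg₂.eq_fracResolvent_of_eq (h.measurableLocallyBounded_stateMean_natCast_sq hα hlam hμ hξ)
      hα ht (h.eqOn_stateMean_natCast_sq hα hlam hμ hξ),
    (hc _).fracResolvent_add_fracIntegral_add_smul (hsource _ _) hm hα le_rfl hα.le ht, zero_add,
    ← hg₁.fracResolvent_succ_of_eq hm hα hα.le ht (h.eqOn_stateMean_natCast hα hlam hμ hξ),
    hp.fracResolvent_one_affine hα ht, hp.fracResolvent_two_affine hα ht]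
  ring

end SolvesForward

theorem measurable_of_measurable_singleton {S T : Type*} [MeasurableSpace S] [MeasurableSpace T]
    [Countable T] [MeasurableSingletonClass T] {κ : S → Measure T}
    (h : ∀ n, Measurable fun s => κ s {n}) : Measurable κ := by
  refine Measure.measurable_of_measurable_coe _ fun A hA => ?_
  simp only [← Measure.tsum_indicator_apply_singleton _ A hA]
  refine Measurable.tsum fun n => ?_
  by_cases hn : n ∈ A
  · simpa only [indicator_of_mem hn] using h n
  · simp only [indicator_of_notMem hn, measurable_const]

theorem queueGenerator_single_zero (lam μ ξ : ℝ) :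
    queueGenerator lam μ ξ (Pi.single 0 1) =
      (-(lam + ξ) • (Pi.single 0 1 : ℕ → ℝ) + μ • (Pi.single 1 1 : ℕ → ℝ)) + fun _ => ξ := by
  funext n
  rcases n with _ | _ | n <;> simp [queueGenerator]

theorem queueGenerator_single_succ (lam μ ξ : ℝ) (n : ℕ) :
    queueGenerator lam μ ξ (Pi.single (n + 1) 1) =
      (-(lam + μ + ξ) • (Pi.single (n + 1) 1 : ℕ → ℝ) + lam • (Pi.single n 1 : ℕ → ℝ))
        + μ • (Pi.single (n + 2) 1 : ℕ → ℝ) := by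
  funext m
  simp only [queueGenerator, LinearMap.coe_mk, AddHom.coe_mk, Pi.add_apply, Pi.smul_apply,
    Pi.single_apply, smul_eq_mul]
  cases m <;> grind

theorem DynkinFormula.of_hasCaputoDerivAt {ν : Kernel ℝ≥0 ℕ} {L : (ℕ → ℝ) →ₗ[ℝ] (ℕ → ℝ)} {α : ℝ}
    {i : ℕ} {φ : ℕ → ℝ} (hα0 : 0 < α) (hα1 : α ≤ 1) (hφ : ∀ t, Integrable φ (ν t))
    (hLφ : ∀ t, Integrable (L φ) (ν t)) (hcont : Continuous (stateMean ν φ))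
    (hcont' : Continuous (stateMean ν (L φ))) (hinit : stateMean ν φ 0 = φ i)
    (h : ∀ t, 0 < t → HasCaputoDerivAt α (stateMean ν φ) (stateMean ν (L φ) t) t) :
    DynkinFormula ν L α i φ :=
  ⟨hφ, hLφ, .of_continuous hcont', fun _ ht =>
    hinit ▸ eq_add_fracIntegral_of_hasCaputoDerivAt hα0 hα1 hcont hcont' h ht⟩

namespace IsFractionalQueue

variable {Ω : Type*} [MeasurableSpace Ω] {P : Measure Ω} {α lam μ ξ : ℝ} {X : ℝ≥0 → Ω → ℕ}
  {i : ℕ}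

theorem continuous_transitionProb (hX : IsFractionalQueue P α lam μ ξ X)
    (hi : P (X 0 ⁻¹' {i}) ≠ 0) (n : ℕ) : Continuous (transitionProb P X i n) := by
  refine ((hX.continuousOn i n hi).comp_continuous (continuous_id.max continuous_const)
    fun t => le_max_right t 0).congr fun t => ?_
  simp [transitionProb, ← Real.coe_toNNReal']

theorem measurable_map_cond (hX : IsFractionalQueue P α lam μ ξ X) (hi : P (X 0 ⁻¹' {i}) ≠ 0) :
    Measurable fun t => (cond P (X 0 ⁻¹' {i})).map (X t) :=
  measurable_of_measurable_singleton fun n => by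
    have hprob : ∀ t : ℝ≥0, (cond P (X 0 ⁻¹' {i})).map (X t) {n} =
        ENNReal.ofReal (transitionProb P X i n t) := fun t => by
      rw [Measure.map_apply (hX.measurable t) (measurableSet_singleton n), transitionProb,
        Real.toNNReal_coe, ofReal_measureReal]
    simp only [hprob]
    exact ((hX.continuous_transitionProb hi n).comp NNReal.continuous_coe).measurable.ennreal_ofReal

/-- The law of the queue conditioned to start in state `i`, as a kernel from times to states. -/
noncomputable def law (hX : IsFractionalQueue P α lam μ ξ X) (hi : P (X 0 ⁻¹' {i}) ≠ 0) :
    Kernel ℝ≥0 ℕ :=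
  ⟨fun t => (cond P (X 0 ⁻¹' {i})).map (X t), hX.measurable_map_cond hi⟩

variable (hX : IsFractionalQueue P α lam μ ξ X) (hi : P (X 0 ⁻¹' {i}) ≠ 0)

theorem isMarkovKernel_law [IsFiniteMeasure P] : IsMarkovKernel (hX.law hi) :=
  have := cond_isProbabilityMeasure hi
  ⟨fun t => Measure.isProbabilityMeasure_map (hX.measurable t).aemeasurable⟩

theorem integrable_law_iff {φ : ℕ → ℝ} {t : ℝ≥0} :
    Integrable φ (hX.law hi t) ↔ Integrable (fun ω => φ (X t ω)) (cond P (X 0 ⁻¹' {i})) :=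
  integrable_map_measure .of_discrete (hX.measurable t).aemeasurable

theorem stateMean_law (φ : ℕ → ℝ) (t : ℝ) :
    stateMean (hX.law hi) φ t = ∫ ω, φ (X t.toNNReal ω) ∂cond P (X 0 ⁻¹' {i}) :=
  integral_map (hX.measurable _).aemeasurable .of_discrete

theorem stateMean_law_single (n : ℕ) :
    stateMean (hX.law hi) (Pi.single n 1) = transitionProb P X i n := by
  funext t
  rw [stateMean_law, transitionProb,
    ← integral_indicator_one (hX.measurable _ (measurableSet_singleton n))]
  simp only [Pi.single_apply, indicator, mem_preimage, mem_singleton_iff, Pi.one_apply]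

variable [IsFiniteMeasure P]

theorem integrable_single (n : ℕ) (t : ℝ≥0) :
    Integrable (Pi.single n 1 : ℕ → ℝ) (hX.law hi t) := by
  have := hX.isMarkovKernel_law hi
  refine integrable_of_abs_le (integrable_const 1) (K := 1) fun m => ?_
  rw [Pi.single_apply]
  split_ifs <;> simp

theorem integrable_queueGenerator_single (n : ℕ) (t : ℝ≥0) :
    Integrable (queueGenerator lam μ ξ (Pi.single n 1)) (hX.law hi t) := by
  have := hX.isMarkovKernel_law hi
  have hint := fun n => hX.integrable_single hi n t
  cases n with
  | zero =>
    rw [queueGenerator_single_zero]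
    exact (((hint 0).smul _).add ((hint 1).smul μ)).add (integrable_const ξ)
  | succ n =>
    rw [queueGenerator_single_succ]
    exact (((hint _).smul _).add ((hint n).smul lam)).add ((hint _).smul μ)

theorem stateMean_queueGenerator_single_zero (t : ℝ) :
    stateMean (hX.law hi) (queueGenerator lam μ ξ (Pi.single 0 1)) t =
      -(lam + ξ) * transitionProb P X i 0 t + μ * transitionProb P X i 1 t + ξ := by
  have := hX.isMarkovKernel_law hi
  have hint := fun n => hX.integrable_single hi n t.toNNReal
  simp only [← hX.stateMean_law_single hi]
  rw [queueGenerator_single_zero, stateMean_add (((hint 0).smul _).add ((hint 1).smul μ))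
    (integrable_const ξ), stateMean_add ((hint 0).smul _) ((hint 1).smul μ), stateMean_const,
    stateMean_smul, stateMean_smul]
  rfl

theorem stateMean_queueGenerator_single_succ (n : ℕ) (t : ℝ) :
    stateMean (hX.law hi) (queueGenerator lam μ ξ (Pi.single (n + 1) 1)) t =
      -(lam + μ + ξ) * transitionProb P X i (n + 1) t + lam * transitionProb P X i n t
        + μ * transitionProb P X i (n + 2) t := by
  have hint := fun n => hX.integrable_single hi n t.toNNReal
  simp only [← hX.stateMean_law_single hi]
  rw [queueGenerator_single_succ, stateMean_add (((hint _).smul _).add ((hint n).smul lam))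
    ((hint _).smul μ), stateMean_add ((hint _).smul _) ((hint n).smul lam),
    stateMean_smul, stateMean_smul, stateMean_smul]
  rfl

theorem solvesForward (hα0 : 0 < α) (hα1 : α ≤ 1) : SolvesForward (hX.law hi) α lam μ ξ i := by
  intro n
  have hcont := hX.continuous_transitionProb hi
  have hmean := hX.stateMean_law_single hi n
  refine .of_hasCaputoDerivAt hα0 hα1 (hX.integrable_single hi n)
    (hX.integrable_queueGenerator_single hi n) (hmean ▸ hcont n) ?_ ?_ fun t ht => ?_
  · cases n with
    | zero =>
      rw [funext (hX.stateMean_queueGenerator_single_zero hi)]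
      fun_prop
    | succ n =>
      rw [funext (hX.stateMean_queueGenerator_single_succ hi n)]
      fun_prop
  · rw [hmean, hX.init i n hi, Pi.single_apply]
  · rw [hmean]
    cases n with
    | zero =>
      rw [hX.stateMean_queueGenerator_single_zero hi]
      exact hX.forward_zero i hi t ht
    | succ n =>
      rw [hX.stateMean_queueGenerator_single_succ hi]
      exact hX.forward_pos i (n + 1) n.succ_pos hi t ht

end IsFractionalQueue

theorem mainTheorem4 {Ω : Type*} [MeasurableSpace Ω] (P : Measure Ω) [IsProbabilityMeasure P]
    (α lam μ ξ : ℝ) (hα0 : 0 < α) (hα1 : α ≤ 1) (hlam : 0 < lam) (hμ : 0 < μ) (hξ : 0 ≤ ξ)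
    (X : ℝ≥0 → Ω → ℕ) (hX : IsFractionalQueue P α lam μ ξ X)
    (i : ℕ) (hi : P (X 0 ⁻¹' {i}) ≠ 0) (t : ℝ≥0) :
    MemLp (fun ω => (X t ω : ℝ)) 2 (cond P (X 0 ⁻¹' {i})) ∧
    (0 < ξ →
      variance (fun ω => (X t ω : ℝ)) (cond P (X 0 ⁻¹' {i})) =
        (i : ℝ) ^ 2 * mittagLeffler 1 α 1 (-ξ * (t : ℝ) ^ α)
          + 2 * i * (t : ℝ) ^ α * (lam - μ) * mittagLeffler 2 α (α + 1) (-ξ * (t : ℝ) ^ α)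
          - μ * mlConv α ξ 1 (transitionProb P X i 0) t
          + 2 * μ * (lam - μ) * mlConv α ξ 2 (transitionProb P X i 0) t
          + (μ + lam) * (t : ℝ) ^ α * mittagLeffler 1 α (α + 1) (-ξ * (t : ℝ) ^ α)
          + 2 * (t : ℝ) ^ (2 * α) * (lam - μ) ^ 2
              * mittagLeffler 2 α (2 * α + 1) (-ξ * (t : ℝ) ^ α)
          - (i * mittagLeffler 1 α 1 (-ξ * (t : ℝ) ^ α)
              + μ * mlConv α ξ 1 (transitionProb P X i 0) t
              + (lam - μ) / ξ * (1 - mittagLeffler 1 α 1 (-ξ * (t : ℝ) ^ α))) ^ 2) ∧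
    variance (fun ω => (X t ω : ℝ)) (cond P (X 0 ⁻¹' {i})) =
        (i : ℝ) ^ 2 * mittagLeffler 1 α 1 (-ξ * (t : ℝ) ^ α)
          + 2 * i * (t : ℝ) ^ α * (lam - μ) * mittagLeffler 2 α (α + 1) (-ξ * (t : ℝ) ^ α)
          - μ * mlConv α ξ 1 (transitionProb P X i 0) t
          + 2 * μ * (lam - μ) * mlConv α ξ 2 (transitionProb P X i 0) t
          + (μ + lam) * (t : ℝ) ^ α * mittagLeffler 1 α (α + 1) (-ξ * (t : ℝ) ^ α)
          + 2 * (t : ℝ) ^ (2 * α) * (lam - μ) ^ 2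
              * mittagLeffler 2 α (2 * α + 1) (-ξ * (t : ℝ) ^ α)
          - (i * mittagLeffler 1 α 1 (-ξ * (t : ℝ) ^ α)
              + μ * mlConv α ξ 1 (transitionProb P X i 0) t
              + (lam - μ) * (t : ℝ) ^ α * mittagLeffler 1 α (α + 1) (-ξ * (t : ℝ) ^ α)) ^ 2 := by
  have := cond_isProbabilityMeasure hi
  have := hX.isMarkovKernel_law hi
  have h := hX.solvesForward hi hα0 hα1
  have hmem : MemLp (fun ω => (X t ω : ℝ)) 2 (cond P (X 0 ⁻¹' {i})) :=
    (memLp_two_iff_integrable_sq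
      (measurable_from_nat.comp (hX.measurable t)).aestronglyMeasurable).2
      ((hX.integrable_law_iff hi).1 (h.integrable_natCast_sq hα0 hlam.le hμ.le hξ t))
  have hmean := h.stateMean_natCast hα0 hlam.le hμ.le hξ t.coe_nonneg
  have hsq := h.stateMean_natCast_sq hα0 hlam.le hμ.le hξ t.coe_nonneg
  rw [hX.stateMean_law hi, hX.stateMean_law_single hi, Real.toNNReal_coe] at hmean hsq
  have hvar := variance_eq_sub hmem
  simp only [Pi.pow_apply, hmean, hsq] at hvar
  refine ⟨hmem, fun hξ0 => ?_, ?_⟩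
  · have hdrift : (lam - μ) / ξ * (1 - mittagLeffler 1 α 1 (-ξ * (t : ℝ) ^ α)) =
        (lam - μ) * (t : ℝ) ^ α * mittagLeffler 1 α (α + 1) (-ξ * (t : ℝ) ^ α) := by
      rw [mittagLeffler_one_eq_one_add hα0]
      field_simp
      ring
    rw [hvar, hdrift]
    ring
  · rw [hvar]
    ring
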